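/- Let $d\ge 2$ and $s\ge 1$ be integers, let $\mathbb F_p$ be a finite field with $p$ elements ($p$ a prime power), and let $R=\mathbb F_p[t]/\langle t^s\rangle$. For $i\in\{1,\dots,d\}$ let $$K_i=\langle e_{j,j+1}(at+b)\;:\;a,b\in\mathbb F_p,\ j\in\{1,\dots,d\}\setminus\{i\}\rangle\le \mathrm{SL}_d(R),\qquad G=\langle K_1,\dots,K_d\rangle,$$ where $e_{j,j+1}(r)$ is the elementary matrix with $1$'s on the diagonal and $r$ in position $(j,j+1)$, indices being taken modulo $d$. Let $\mathcal X=\mathcal X(G,\{K_1,\dots,K_d\})$ be the $(d-1)$-dimensional coset complex: its vertices are the left cosets $gK_i$, its top faces are the sets $\{gK_1,\dots,gK_d\}$ with $g\in G$, and its faces are all subsets of top faces. The weight $w(\sigma)$ of a face $\sigma$ is the probability of obtaining $\sigma$ by choosing a uniformly random top face and then a uniformly random subset of it of size $|\sigma|$; the skeleta of $\mathcal X$ carry the restriction of $w$. A pure $D$-dimensional simplicial complex $X$ with a weight $w\ge 0$ is called a weighted complex if $w$ is balanced, i.e. $\sum_{\sigma\in X(D)}w(\sigma)=1$ and $w(\sigma)=\frac1{i+2}\sum_{\tau\in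 X(i+1),\,\tau\supset\sigma}w(\tau)$ for every $\sigma\in X(i)$, $-1\le i<D$. The link $X_S=\{T\setminus S: S\subseteq T\in X\}$ of a face $S$ carries the weight $w_S(\tau)=w(S\cup\tau)\big/\big(\binom{|S|+|\tau|}{|S|}w(S)\big)$. A weighted graph is a $\lambda$-spectral expander if its normalized adjacency matrix $A(u,v)=\frac{w(\{u,v\})}{2\,w(\{u\})}$ for edges $\{u,v\}$ ($0$ otherwise), which is the transition matrix of the weighted random walk, has real eigenvalues $\lambda_1\ge\lambda_2\ge\dots\ge\lambda_n$ (with multiplicity, $n\ge 2$) with $\max\{\lambda_2,|\lambda_n|\}\le\lambda$. A weighted complex of dimension $D\ge1$ is a two-sided $\lambda$-spectral HDX if the weighted $1$-skeleton of the link of every face of dimension $-1\le i\le D-2$ is a $\lambda$-spectral expander. If $p>(d-2)^2$, then for every $1\le k<d$ the $k$-skeleton of $\mathcal X$ is a two-sided $\lambda$-spectral HDX (of dimension $k$) with $$\lambda=\max\left\{\frac1{\sqrt p-(d-2)},\ \frac1{d-k}\right\}.$$ In particular, for $k=1$, the weighted $1$-skeleton of $\mathcal X$ is a $\max\left\{\frac1{\sqrt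 p-(d-2)},\frac1{d-1}\right\}$-spectral expander graph. -/

import Mathlib

noncomputable section

/-- An abstract simplicial complex on a vertex universe `U`: a collection of finite subsets of `U`
closed under taking subsets. The empty set is a face of every non-empty complex. -/
structure SComplex (U : Type*) where
  faces : Set (Finset U)
  down_closed : ∀ {σ τ : Finset U}, σ ∈ faces → τ ⊆ σ → τ ∈ faces

namespace SComplex

variable {U : Type*}

/-- The `k`-skeleton: all faces of dimension at most `k`, i.e. with at most `k + 1` elements. -/
def skeleton (X : SComplex U) (k : ℕ) : SComplex U where
  faces := {σ | σ ∈ X.faces ∧ σ.card ≤ k + 1}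
  down_closed := fun hσ hτ =>
    ⟨X.down_closed hσ.1 hτ, (Finset.card_le_card hτ).trans hσ.2⟩

open Classical in
/-- The link `X_S = {T \ S : T ∈ X, S ⊆ T}`. -/
def link (X : SComplex U) (S : Finset U) : SComplex U where
  faces := {τ | ∃ T ∈ X.faces, S ⊆ T ∧ τ = T \ S}
  down_closed := by
    rintro _ ρ ⟨T, hT, hST, rfl⟩ hρ
    refine ⟨S ∪ ρ, X.down_closed hT (Finset.union_subset hST (hρ.trans Finset.sdiff_subset)),
      Finset.subset_union_left, ?_⟩
    rw [Finset.union_sdiff_left,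
      Finset.sdiff_eq_self_of_disjoint (Finset.disjoint_of_subset_left hρ Finset.sdiff_disjoint)]

/-- `X` is pure of dimension `D`: it has a face of dimension `D`, and every face is contained in a
face of dimension `D`. -/
def IsPureOfDim (X : SComplex U) (D : ℕ) : Prop :=
  (∃ T ∈ X.faces, T.card = D + 1) ∧ ∀ σ ∈ X.faces, ∃ T ∈ X.faces, σ ⊆ T ∧ T.card = D + 1

variable [Fintype U]

open Classical in
/-- `(X, w)` is a weighted simplicial complex of dimension `D`: `X` is pure of dimension `D`, and
`w ≥ 0` is balanced. A face `σ` of dimension `i` has `i + 1` elements. -/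
def IsWeighted (X : SComplex U) (w : Finset U → ℝ) (D : ℕ) : Prop :=
  X.IsPureOfDim D ∧
  (∀ σ ∈ X.faces, 0 ≤ w σ) ∧
  (∑ σ : Finset U with σ ∈ X.faces ∧ σ.card = D + 1, w σ) = 1 ∧
  ∀ σ ∈ X.faces, σ.card ≤ D →
    w σ = 1 / ((σ.card : ℝ) + 1) *
      ∑ τ : Finset U with τ ∈ X.faces ∧ σ ⊆ τ ∧ τ.card = σ.card + 1, w τ

open Classical in
/-- The balanced weight induced by the uniform distribution on the faces with `m` elements (the top
faces): `w σ` is the probability that `σ` is obtained by choosing a top face uniformly at random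
and then a uniformly random subset of size `|σ|` of it. -/
def uniformWeight (X : SComplex U) (m : ℕ) (σ : Finset U) : ℝ :=
  ((Finset.univ.filter fun T : Finset U => T ∈ X.faces ∧ T.card = m ∧ σ ⊆ T).card : ℝ) /
    (((Finset.univ.filter fun T : Finset U => T ∈ X.faces ∧ T.card = m).card : ℝ) *
      (m.choose σ.card : ℝ))

open Classical in
/-- The balanced weight on the link of `S`: the restriction of `w`, normalised so that in each
dimension it is a probability distribution. (If `w` is balanced, the sum of `w T` over the faces
`T ⊇ S` with `m` elements is `(m choose |S|) * w S`.) -/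
def linkWeight (w : Finset U → ℝ) (S : Finset U) (τ : Finset U) : ℝ :=
  w (S ∪ τ) / (((S.card + τ.card).choose S.card : ℝ) * w S)

/-- The vertices of `X`, i.e. the elements of `X(0)`. -/
abbrev Vert (X : SComplex U) : Type _ := {v : U // {v} ∈ X.faces}

instance (X : SComplex U) : Fintype X.Vert := Fintype.ofFinite _

open Classical in
/-- The normalised adjacency matrix of the weighted graph given by the vertices and edges of `X`
(the transition matrix of the weighted random walk). The weight `w {u, v}` of an edge is shared
equally by the two oriented edges `(u, v)` and `(v, u)`; with this convention the balance condition
says that `w {u}` is the sum of the weights of the oriented edges leaving `u`, so that all rows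
sum to one. -/
def adjMatrix (X : SComplex U) (w : Finset U → ℝ) : Matrix X.Vert X.Vert ℝ :=
  fun u v => if u ≠ v ∧ ({u.1, v.1} : Finset U) ∈ X.faces then
    (w {u.1, v.1} / 2) / w {u.1} else 0

open Classical in
/-- Two-sided spectral expansion of a weighted graph: the normalised adjacency matrix has real
eigenvalues `ev 0 ≥ ev 1 ≥ ⋯ ≥ ev (n + 1)`, listed with multiplicity, and both the second largest
one and the absolute value of the smallest one are at most `lam`. -/
def IsSpectralExpander (X : SComplex U) (w : Finset U → ℝ) (lam : ℝ) : Prop :=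
  ∃ (n : ℕ) (ev : Fin (n + 2) → ℝ), Antitone ev ∧
    (X.adjMatrix w).charpoly = ∏ i, (Polynomial.X - Polynomial.C (ev i)) ∧
    max (ev 1) |ev (Fin.last (n + 1))| ≤ lam

/-- `(X, w)` is a `D`-dimensional weighted simplicial complex, `D ≥ 1`, which is a (two-sided)
`lam`-spectral HDX: for every face `s` of dimension `-1 ≤ i ≤ D - 2`, the weighted `1`-skeleton of
the link of `s` is a `lam`-spectral expander. -/
def IsSpectralHDX (X : SComplex U) (w : Finset U → ℝ) (D : ℕ) (lam : ℝ) : Prop :=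
  1 ≤ D ∧ X.IsWeighted w D ∧
  ∀ s ∈ X.faces, s.card + 1 ≤ D →
    ((X.link s).skeleton 1).IsSpectralExpander (linkWeight w s) lam

end SComplex

section CosetComplex

variable {ι G : Type*} [Group G]

/-- The vertices of a coset complex: the left cosets of `K i`, which are of type `i`. -/
def CosetVertex (K : ι → Subgroup G) : Type _ := Σ i : ι, G ⧸ K i

instance (K : ι → Subgroup G) [Finite ι] [Finite G] : Fintype (CosetVertex K) :=
  @Fintype.ofFinite _ (inferInstanceAs (Finite (Σ i : ι, G ⧸ K i)))

open Classical in
/-- The top face `{g K_i : i ∈ ι}`. -/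
def cosetTopFace [Fintype ι] (K : ι → Subgroup G) (g : G) : Finset (CosetVertex K) :=
  Finset.univ.image fun i => (⟨i, (QuotientGroup.mk g : G ⧸ K i)⟩ : CosetVertex K)

/-- The coset complex: the top faces are the sets `{g K_i : i ∈ ι}` with `g ∈ G`, and the faces
are all subsets of top faces. -/
def cosetComplex [Fintype ι] (K : ι → Subgroup G) : SComplex (CosetVertex K) where
  faces := {σ | ∃ g : G, σ ⊆ cosetTopFace K g}
  down_closed := fun ⟨g, hg⟩ hτ => ⟨g, hτ.trans hg⟩

end CosetComplex

namespace KaufmanOppenheim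

open Polynomial

variable (F : Type*) [Field F] (s d : ℕ)

/-- The ring `R = F[t] / (t ^ s)`. -/
abbrev R : Type _ := F[X] ⧸ Ideal.span {(X ^ s : F[X])}

instance finite_R [Finite F] : Finite (R F s) := by
  have h : Module.Finite F (AdjoinRoot (X ^ s : F[X])) := (monic_X_pow s).finite_adjoinRoot
  exact Module.finite_of_finite F (M := AdjoinRoot (X ^ s : F[X]))

/-- The element `a t + b` of `R`. -/
def linElt (a b : F) : R F s := Ideal.Quotient.mk _ (C a * X + C b)

/-- The subgroup of `SL_d(R)` generated by the elementary matrices `e_{j,j+1}(a t + b)` with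
`a, b ∈ F` and `j ≠ i`, where `j + 1` is taken modulo `d`. -/
def subgroupSL (i : Fin d) : Subgroup (Matrix.SpecialLinearGroup (Fin d) (R F s)) :=
  Subgroup.closure {A | ∃ j : Fin d, j ≠ i ∧ ∃ a b : F,
    (A : Matrix (Fin d) (Fin d) (R F s)) = Matrix.transvection j (finRotate d j) (linElt F s a b)}

/-- The group `G` generated by all these subgroups. -/
def G : Subgroup (Matrix.SpecialLinearGroup (Fin d) (R F s)) := ⨆ i, subgroupSL F s d i

/-- The subgroups `K_i`, as subgroups of `G`. -/
def K (i : Fin d) : Subgroup (G F s d) := (subgroupSL F s d i).subgroupOf (G F s d)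

instance finite_G [Finite F] : Finite (G F s d) :=
  have : Finite (Matrix.SpecialLinearGroup (Fin d) (R F s)) :=
    inferInstanceAs (Finite {A : Matrix (Fin d) (Fin d) (R F s) // A.det = 1})
  inferInstance

/-- The coset complex of Kaufman and Oppenheim, of dimension `d - 1`. -/
def complex : SComplex (CosetVertex (K F s d)) := cosetComplex (K F s d)

/-- Its weight function, induced by the uniform distribution on the top faces. -/
def weight [Finite F] : Finset (CosetVertex (K F s d)) → ℝ := (complex F s d).uniformWeight d

end KaufmanOppenheim

end

/-!
The skeleta of the coset complex are expanders because its smallest links are, by a local-to-global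
argument. Everything is phrased by counting top faces, and `p = |F|`. The top faces are indexed by
`g : G`, and for a face `S` and a function `f` on the vertices of its link, `linkSum` is the sum of
`f` over the vertices of one top face. The quadratic form of the random walk on the link is then a
sum over the top faces `g ⊇ S` of `linkSum f g ^ 2 - linkSum (f ^ 2) g`, up to normalisation, and the normalised
adjacency matrix of the link does not depend on the skeleton in which the link is taken
(`adjMatrix_link_skeleton`).

*Smallest eigenvalue.* With `n = d - |S|` vertices of the link in each top face, the sums of squares
`linkSum f g ^ 2` are nonnegative, so no eigenvalue is below `-1 / (n - 1)`, and
`n - 1 ≥ d - k` for the links that occur in the `k`-skeleton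
(`IsLocalExpander.exists_eigenvalues`).

*Second eigenvalue.* Oppenheim's trickling-down theorem (`IsLocalExpander.trickle_down`): if the
links of all faces `insert v S` have second eigenvalue at most `lam < 1` and the link of `S` is
connected, then the link of `S` has second eigenvalue at most `lam / (1 - lam)`. Starting from
`1 / √p` in codimension two, the bound after `m` steps is `1 / (√p - m)`, and there are at most
`d - 2` steps. For `d = 2` there is nothing to prove, since the claimed bound is at least `1`.

*Stabilisers.* For a nonempty set `T` of types, the intersection of the `K_i` with `i ∈ T` is
generated by the `e_{j,j+1}(a t + b)` with `j ∉ T` (`cosetStabilizer_eq_genSub`). Matrices in the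
intersection have entries of bounded degree in `t`, supported where the cyclic arc from the row to
the column avoids `T` (`IsStaircase`), and column-wise Gaussian elimination writes such a matrix as
a product of elementary matrices which are iterated commutators of the generators. Connectivity
of the links follows (`isLinkConnected_coset`).

*Codimension two.* The link of a face of cotype `{i, j}` is the coset graph of two abelian subgroups
which commute, or which generate a Heisenberg group with the multiplication of linear
polynomials as commutator pairing. Squaring the adjacency operator gives a convolution operator on a
finite abelian group, whose Fourier coefficients at nontrivial characters are at most `1 / p`: a
nontrivial character of the centre is trivial on the products `a * δ`, for all `a`, only when `δ`
lies in a proper `F`-subspace (`norm_sum_addChar_le`, `heisenberg_group_bound`). This holds for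
every `s`, including those for which `t ^ 2 = 0` in `R`.
-/

open Finset

/-! ### Spectra of reversible weighted graphs -/

section Spectral

variable {V : Type*} [Fintype V]

/-- The spectral theorem for the transition matrix `W u v / m u` of a reversible walk: it is
self-adjoint for the inner product weighted by `m`, so it has a basis of eigenfunctions which is
orthonormal for that inner product. The eigenvalues are listed in decreasing order. -/
theorem exists_weighted_eigenbasis [DecidableEq V] {W : V → V → ℝ} (hW : ∀ u v, W u v = W v u)
    {m : V → ℝ} (hm : ∀ u, 0 < m u) :
    ∃ (ev : Fin (Fintype.card V) → ℝ) (φ : Fin (Fintype.card V) → V → ℝ), Antitone ev ∧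
      (Matrix.charpoly (fun u v => W u v / m u : Matrix V V ℝ) =
        ∏ i, (Polynomial.X - Polynomial.C (ev i))) ∧
      (∀ i j, ∑ u, m u * φ i u * φ j u = if i = j then 1 else 0) ∧
      (∀ i u, ∑ v, W u v * φ i v = ev i * (m u * φ i u)) ∧
      ∀ (f : V → ℝ) (u : V), f u = ∑ i, (∑ v, m v * f v * φ i v) * φ i u := by
  have hs : ∀ u, 0 < √(m u) := fun u => Real.sqrt_pos.2 (hm u)
  have hss : ∀ u, √(m u) * √(m u) = m u := fun u => Real.mul_self_sqrt (hm u).le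
  set S : Matrix V V ℝ := fun u v => W u v / (√(m u) * √(m v)) with hS
  have hH : S.IsHermitian := by
    ext u v
    change W v u / (√(m v) * √(m u)) = W u v / (√(m u) * √(m v))
    rw [hW v u, mul_comm]
  set e : Fin (Fintype.card V) ≃ V := Fintype.equivOfCardEq (Fintype.card_fin _) with he
  set b := hH.eigenvectorBasis with hb
  refine ⟨hH.eigenvalues₀, fun i u => b (e i) u / √(m u), hH.eigenvalues₀_antitone, ?_, ?_, ?_, ?_⟩
  · have hconj : (fun u v => W u v / m u : Matrix V V ℝ) =
        Matrix.diagonal (fun u => (√(m u))⁻¹) * (S * Matrix.diagonal (fun u => √(m u))) := by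
      ext u v
      rw [Matrix.diagonal_mul, Matrix.mul_diagonal]
      have h1 := (hs u).ne'
      have h2 := (hs v).ne'
      simp only [hS]
      have h3 : W u v / m u = W u v / (√(m u) * √(m u)) := by rw [hss]
      rw [h3]
      field_simp
    have hdiag : Matrix.diagonal (fun u => √(m u)) * Matrix.diagonal (fun u => (√(m u))⁻¹) =
        (1 : Matrix V V ℝ) := by
      rw [Matrix.diagonal_mul_diagonal, ← Matrix.diagonal_one]
      congr 1
      ext u
      exact mul_inv_cancel₀ (hs u).ne'
    rw [hconj, Matrix.charpoly_mul_comm, Matrix.mul_assoc, hdiag, Matrix.mul_one, hH.charpoly_eq,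
      ← Equiv.prod_comp e]
    refine Finset.prod_congr rfl fun i _ => ?_
    simp [Matrix.IsHermitian.eigenvalues, he]
  · intro i j
    have h := orthonormal_iff_ite.1 b.orthonormal (e i) (e j)
    simp only [EmbeddingLike.apply_eq_iff_eq] at h
    rw [← h, PiLp.inner_apply]
    refine Finset.sum_congr rfl fun u _ => ?_
    have h1 := (hs u).ne'
    simp only [RCLike.inner_apply, conj_trivial]
    nth_rw 1 [← hss u]
    field_simp
  · intro i u
    have h := congrFun (hH.mulVec_eigenvectorBasis (e i)) u
    simp only [Matrix.mulVec, dotProduct, Pi.smul_apply, smul_eq_mul] at h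
    have hev : hH.eigenvalues (e i) = hH.eigenvalues₀ i := by
      simp [Matrix.IsHermitian.eigenvalues, he]
    rw [hev] at h
    have h1 := (hs u).ne'
    have : hH.eigenvalues₀ i * (m u * (b (e i) u / √(m u))) =
        √(m u) * (hH.eigenvalues₀ i * b (e i) u) := by
      nth_rw 1 [← hss u]
      field_simp
    rw [this, ← h, Finset.mul_sum]
    refine Finset.sum_congr rfl fun v _ => ?_
    have h2 := (hs v).ne'
    simp only [hS]
    field_simp
    rfl
  · intro f u
    have h := b.sum_repr' (WithLp.toLp 2 fun v => √(m v) * f v)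
    have h' := congrArg (fun x : EuclideanSpace ℝ V => x u) h
    simp only [WithLp.ofLp_sum, WithLp.ofLp_smul, Finset.sum_apply, Pi.smul_apply,
      smul_eq_mul] at h'
    rw [← Equiv.sum_comp e] at h'
    have h1 := (hs u).ne'
    have h2 : f u = (√(m u) * f u) / √(m u) := by field_simp
    rw [h2, ← h', Finset.sum_div]
    refine Finset.sum_congr rfl fun i _ => ?_
    rw [mul_div_assoc]
    congr 1
    rw [PiLp.inner_apply]
    refine Finset.sum_congr rfl fun v _ => ?_
    have h3 := (hs v).ne'
    simp only [RCLike.inner_apply, conj_trivial]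
    nth_rw 2 [← hss v]
    field_simp

/-- Parseval's identity and the diagonalised quadratic form, from an expansion in
eigenfunctions. -/
theorem quadratic_form_expansion {ι : Type*} [Fintype ι] {W : V → V → ℝ} {m : V → ℝ} {ev : ι → ℝ}
    {φ : ι → V → ℝ} (hev : ∀ i u, ∑ v, W u v * φ i v = ev i * (m u * φ i u)) (f : V → ℝ)
    (hf : ∀ u, f u = ∑ i, (∑ v, m v * f v * φ i v) * φ i u) :
    ∑ u, m u * f u ^ 2 = ∑ i, (∑ v, m v * f v * φ i v) ^ 2 ∧
      ∑ u, ∑ v, W u v * f u * f v = ∑ i, ev i * (∑ v, m v * f v * φ i v) ^ 2 := by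
  set c : ι → ℝ := fun i => ∑ v, m v * f v * φ i v with hc
  have hf' : ∀ u, f u = ∑ i, c i * φ i u := hf
  constructor
  · calc ∑ u, m u * f u ^ 2 = ∑ u, ∑ i, c i * (m u * f u * φ i u) := by
          refine Finset.sum_congr rfl fun u _ => ?_
          have : m u * f u ^ 2 = m u * f u * ∑ i, c i * φ i u := by rw [← hf']; ring
          rw [this, Finset.mul_sum]
          exact Finset.sum_congr rfl fun i _ => by ring
      _ = ∑ i, c i ^ 2 := by
          rw [Finset.sum_comm]
          refine Finset.sum_congr rfl fun i _ => ?_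
          rw [← Finset.mul_sum, sq]
  · have key : ∀ u, ∑ v, W u v * f v = ∑ i, c i * (ev i * (m u * φ i u)) := by
      intro u
      calc ∑ v, W u v * f v = ∑ v, ∑ i, c i * (W u v * φ i v) := by
            refine Finset.sum_congr rfl fun v _ => ?_
            rw [hf' v, Finset.mul_sum]
            exact Finset.sum_congr rfl fun i _ => by ring
        _ = _ := by
            rw [Finset.sum_comm]
            refine Finset.sum_congr rfl fun i _ => ?_
            rw [← Finset.mul_sum, hev]
    calc ∑ u, ∑ v, W u v * f u * f v = ∑ u, ∑ i, ev i * c i * (m u * f u * φ i u) := by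
          refine Finset.sum_congr rfl fun u _ => ?_
          have : ∑ v, W u v * f u * f v = f u * ∑ v, W u v * f v := by
            rw [Finset.mul_sum]
            exact Finset.sum_congr rfl fun v _ => by ring
          rw [this, key, Finset.mul_sum]
          exact Finset.sum_congr rfl fun i _ => by ring
      _ = ∑ i, ev i * c i ^ 2 := by
          rw [Finset.sum_comm]
          refine Finset.sum_congr rfl fun i _ => ?_
          rw [← Finset.mul_sum, mul_assoc, sq]

/-- Bounds on the quadratic form of a reversible walk, from above on functions of mean zero and
from below on all functions, bound the second largest and the smallest eigenvalue. -/
theorem exists_eigenvalues_of_quadratic_bounds [DecidableEq V]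
    {W : V → V → ℝ} (hW : ∀ u v, W u v = W v u)
    {m : V → ℝ} (hm : ∀ u, 0 < m u) (hcard : 2 ≤ Fintype.card V) {lam : ℝ}
    (hup : ∀ f : V → ℝ, ∑ u, m u * f u = 0 →
      ∑ u, ∑ v, W u v * f u * f v ≤ lam * ∑ u, m u * f u ^ 2)
    (hlow : ∀ f : V → ℝ, -lam * ∑ u, m u * f u ^ 2 ≤ ∑ u, ∑ v, W u v * f u * f v) :
    ∃ (n : ℕ) (ev : Fin (n + 2) → ℝ), Antitone ev ∧
      Matrix.charpoly (fun u v => W u v / m u : Matrix V V ℝ) =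
        ∏ i, (Polynomial.X - Polynomial.C (ev i)) ∧
      max (ev 1) |ev (Fin.last (n + 1))| ≤ lam := by
  have hbasis := exists_weighted_eigenbasis hW hm
  obtain ⟨n, hn⟩ : ∃ n, Fintype.card V = n + 2 := ⟨Fintype.card V - 2, by omega⟩
  rw [hn] at hbasis
  obtain ⟨ev, φ, hanti, hchar, horth, hev, hexp⟩ := hbasis
  have hform := fun f => quadratic_form_expansion hev f (hexp f)
  have hlast : -lam ≤ ev (Fin.last (n + 1)) := by
    have h := hlow (φ (Fin.last (n + 1)))
    rw [(hform _).1, (hform _).2] at h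
    simp only [horth] at h
    simpa using h
  have hone : ev 1 ≤ lam := by
    -- some combination of the two top eigenfunctions has mean zero
    obtain ⟨a, b, hab, hmean⟩ : ∃ a b : ℝ, a ^ 2 + b ^ 2 ≠ 0 ∧
        a * ∑ u, m u * φ 0 u + b * ∑ u, m u * φ 1 u = 0 := by
      by_cases h : ∑ u, m u * φ 0 u = 0
      · exact ⟨1, 0, by norm_num, by rw [h]; ring⟩
      · refine ⟨∑ u, m u * φ 1 u, -∑ u, m u * φ 0 u, ?_, by ring⟩
        have : 0 < (∑ u, m u * φ 0 u) ^ 2 := by positivity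
        nlinarith [sq_nonneg (∑ u, m u * φ 1 u)]
    set f : V → ℝ := fun u => a * φ 0 u + b * φ 1 u with hf
    have h := hup f (by
      rw [← hmean, Finset.mul_sum, Finset.mul_sum, ← Finset.sum_add_distrib]
      exact Finset.sum_congr rfl fun u _ => by simp only [hf]; ring)
    have hcoef : ∀ i, ∑ v, m v * f v * φ i v =
        a * (if 0 = i then 1 else 0) + b * (if 1 = i then 1 else 0) := by
      intro i
      rw [← horth 0 i, ← horth 1 i, Finset.mul_sum, Finset.mul_sum, ← Finset.sum_add_distrib]
      exact Finset.sum_congr rfl fun u _ => by simp only [hf]; ring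
    have hsum : ∀ g : Fin (n + 2) → ℝ,
        ∑ i, g i * (∑ v, m v * f v * φ i v) ^ 2 = g 0 * a ^ 2 + g 1 * b ^ 2 := by
      intro g
      simp only [hcoef]
      rw [Fin.sum_univ_succ, Fin.sum_univ_succ]
      have : ∀ i : Fin n, (0 : Fin (n + 2)) ≠ i.succ.succ ∧ (1 : Fin (n + 2)) ≠ i.succ.succ := by
        intro i
        constructor <;> intro h <;> simp [Fin.ext_iff] at h
      simp [this]
    have h1 := hsum fun _ => 1
    simp only [one_mul] at h1
    rw [(hform f).1, (hform f).2, hsum, h1] at h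
    have h01 : ev 1 ≤ ev 0 := hanti (Fin.zero_le _)
    have hpos : 0 < a ^ 2 + b ^ 2 := lt_of_le_of_ne (by positivity) hab.symm
    have : ev 1 * (a ^ 2 + b ^ 2) ≤ lam * (a ^ 2 + b ^ 2) := by nlinarith [sq_nonneg a]
    exact le_of_mul_le_mul_right this hpos
  exact ⟨n, ev, hanti, hchar, max_le hone (abs_le.2 ⟨hlast, (hanti (Fin.le_last _)).trans hone⟩)⟩

/-- On functions of mean zero, the quadratic form of a reversible walk is bounded by any bound on
the eigenvalues of eigenfunctions of mean zero. -/
theorem quadratic_bound_of_eigenvalue_bound {W : V → V → ℝ} (hW : ∀ u v, W u v = W v u)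
    {m : V → ℝ} (hm : ∀ u, 0 < m u) (hrow : ∀ u, ∑ v, W u v = m u) {lam : ℝ}
    (h : ∀ (μ : ℝ) (f : V → ℝ), f ≠ 0 → ∑ u, m u * f u = 0 →
      (∀ u, ∑ v, W u v * f v = μ * (m u * f u)) → μ ≤ lam)
    (f : V → ℝ) (hf : ∑ u, m u * f u = 0) :
    ∑ u, ∑ v, W u v * f u * f v ≤ lam * ∑ u, m u * f u ^ 2 := by
  classical
  obtain ⟨ev, φ, -, -, horth, hev, hexp⟩ := exists_weighted_eigenbasis hW hm
  obtain ⟨h1, h2⟩ := quadratic_form_expansion hev f (hexp f)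
  rw [h1, h2, Finset.mul_sum]
  refine Finset.sum_le_sum fun i _ => ?_
  have hne : φ i ≠ 0 := by
    intro h0
    have := horth i i
    simp [h0] at this
  -- an eigenfunction with eigenvalue other than `1` has mean zero
  have hmean : (1 - ev i) * ∑ u, m u * φ i u = 0 := by
    have h3 : ∑ u, ∑ v, W u v * φ i v = ev i * ∑ u, m u * φ i u := by
      rw [Finset.mul_sum]
      exact Finset.sum_congr rfl fun u _ => hev i u
    have h4 : ∑ u, ∑ v, W u v * φ i v = ∑ u, m u * φ i u := by
      rw [Finset.sum_comm]
      refine Finset.sum_congr rfl fun v _ => ?_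
      rw [← Finset.sum_mul, ← hrow v]
      congr 1
      exact Finset.sum_congr rfl fun u _ => hW u v
    linarith
  rcases mul_eq_zero.1 hmean with h5 | h5
  · -- eigenvalue `1`: subtract the mean
    have hev1 : ev i = 1 := by linarith
    set M := ∑ u, m u
    set c := (∑ u, m u * φ i u) / M with hc
    by_cases h0 : (fun u => φ i u - c) = 0
    · have hconst : ∀ u, φ i u = c := fun u => sub_eq_zero.1 (congrFun h0 u)
      have : ∑ v, m v * f v * φ i v = 0 := by
        simp only [hconst]
        rw [← Finset.sum_mul, hf, zero_mul]
      rw [this]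
      simp
    · have hM : M ≠ 0 := by
        obtain ⟨u, -⟩ := Function.ne_iff.1 hne
        exact (Finset.sum_pos (fun u _ => hm u) ⟨u, Finset.mem_univ u⟩).ne'
      refine mul_le_mul_of_nonneg_right (h (ev i) _ h0 ?_ fun u => ?_) (sq_nonneg _)
      · simp only [mul_sub, Finset.sum_sub_distrib]
        rw [← Finset.sum_mul, hc, mul_div_cancel₀ _ hM, sub_self]
      · simp only [mul_sub, Finset.sum_sub_distrib]
        rw [← Finset.sum_mul, hrow, hev, hev1]
        ring
  · exact mul_le_mul_of_nonneg_right (h (ev i) (φ i) hne h5 (hev i)) (sq_nonneg _)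

end Spectral

/-! ### Local expansion of a family of top faces and the trickling-down theorem -/

section LocalExpansion

variable {Γ U : Type*} [DecidableEq U]

/-- The sum of `f` over the vertices of the top face `g` in the link of `s`. -/
def linkSum (top : Γ → Finset U) (s : Finset U) (f : U → ℝ) (g : Γ) : ℝ := ∑ u ∈ top g \ s, f u

/-- Removing one vertex `v` of the link from a top face. -/
theorem linkSum_insert {top : Γ → Finset U} {s : Finset U} {g : Γ} {v : U}
    (hv : v ∈ top g \ s) (f : U → ℝ) :
    linkSum top (insert v s) f g = linkSum top s f g - f v := by
  have h : top g \ insert v s = (top g \ s).erase v := by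
    ext u
    simp only [mem_sdiff, mem_insert, mem_erase]
    tauto
  rw [linkSum, linkSum, h, ← add_sum_erase _ f hv]
  ring

variable [Fintype Γ]

/-- The indices of the top faces that contain `s`. Top faces are indexed by a finite type `Γ`. -/
def topsOver (top : Γ → Finset U) (s : Finset U) : Finset Γ := univ.filter fun g => s ⊆ top g

/-- The random walk on the vertices of the link of `s` has second largest eigenvalue at most `lam`.
With `n = d - |s|` vertices of the link in each top face and `S g` the sum of `f` over these
vertices, the quadratic form of the walk is `∑ g, (S g ^ 2 - ∑ u, f u ^ 2) / (n - 1)` and the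
squared norm of `f` is `∑ g, ∑ u, f u ^ 2`. -/
def IsLocalExpander (top : Γ → Finset U) (d : ℕ) (s : Finset U) (lam : ℝ) : Prop :=
  ∀ f : U → ℝ, ∑ g ∈ topsOver top s, linkSum top s f g = 0 →
    ∑ g ∈ topsOver top s, linkSum top s f g ^ 2 ≤
      (1 + lam * ((d : ℝ) - s.card - 1)) * ∑ g ∈ topsOver top s, linkSum top s (fun u => f u ^ 2) g

/-- The link of `s` is connected: a function on its vertices which is constant on every face is
constant. -/
def IsLinkConnected (top : Γ → Finset U) (s : Finset U) : Prop :=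
  ∀ f : U → ℝ, (∀ g ∈ topsOver top s, ∀ u ∈ top g \ s, ∀ v ∈ top g \ s, f u = f v) →
    ∃ c, ∀ g ∈ topsOver top s, ∀ u ∈ top g \ s, f u = c

variable {top : Γ → Finset U} {d : ℕ} {s : Finset U}

theorem mem_topsOver {g : Γ} : g ∈ topsOver top s ↔ s ⊆ top g := by simp [topsOver]

theorem card_link_top (htop : ∀ g, (top g).card = d) {g : Γ} (hg : g ∈ topsOver top s) :
    ((top g \ s).card : ℝ) = d - s.card := by
  have h := card_sdiff_add_card_eq_card (mem_topsOver.1 hg)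
  rw [htop] at h
  rw [← h]
  push_cast
  ring

theorem linkSum_const (htop : ∀ g, (top g).card = d) {g : Γ} (hg : g ∈ topsOver top s) (c : ℝ) :
    linkSum top s (fun _ => c) g = (d - s.card) * c := by
  rw [linkSum, sum_const, nsmul_eq_mul, card_link_top htop hg]

/-- Choosing a vertex of the link and then a top face, or a top face and then one of its
vertices. -/
theorem sum_link_vertices_tops [Fintype U] (F : U → Γ → ℝ) :
    ∑ v with v ∉ s, ∑ g ∈ topsOver top (insert v s), F v g =
      ∑ g ∈ topsOver top s, ∑ v ∈ top g \ s, F v g := by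
  refine sum_comm' fun v g => ?_
  simp only [mem_filter, mem_univ, true_and, mem_topsOver, insert_subset_iff, mem_sdiff]
  tauto

theorem sum_card_mul [Fintype U] (f : U → ℝ) :
    ∑ v with v ∉ s, ((topsOver top (insert v s)).card : ℝ) * f v =
      ∑ g ∈ topsOver top s, linkSum top s f g := by
  simp only [linkSum]
  rw [← sum_link_vertices_tops]
  exact sum_congr rfl fun v _ => by rw [sum_const, nsmul_eq_mul]

/-- The quadratic form of the walk on the link of `s`, in terms of the means over the links of
the faces `insert v s`. -/
theorem sum_mul_linkSum_insert [Fintype U] (f : U → ℝ) :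
    ∑ v with v ∉ s, f v * ∑ g ∈ topsOver top (insert v s), linkSum top (insert v s) f g =
      ∑ g ∈ topsOver top s, linkSum top s f g ^ 2 -
        ∑ g ∈ topsOver top s, linkSum top s (fun u => f u ^ 2) g := by
  simp only [mul_sum]
  rw [sum_link_vertices_tops, ← sum_sub_distrib]
  refine sum_congr rfl fun g _ => ?_
  rw [sum_congr rfl fun v hv => by rw [linkSum_insert hv f]]
  simp only [mul_sub, sum_sub_distrib, sq]
  rw [← sum_mul]
  rfl

theorem sum_linkSum_sq_insert [Fintype U] (htop : ∀ g, (top g).card = d) (f : U → ℝ) :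
    ∑ v with v ∉ s, ∑ g ∈ topsOver top (insert v s), linkSum top (insert v s) f g ^ 2 =
      ((d : ℝ) - s.card - 2) * ∑ g ∈ topsOver top s, linkSum top s f g ^ 2 +
        ∑ g ∈ topsOver top s, linkSum top s (fun u => f u ^ 2) g := by
  rw [sum_link_vertices_tops, mul_sum, ← sum_add_distrib]
  refine sum_congr rfl fun g hg => ?_
  rw [sum_congr rfl fun v hv => by rw [linkSum_insert hv f]]
  simp only [sub_sq, sum_add_distrib, sum_sub_distrib, sum_const, nsmul_eq_mul]
  rw [card_link_top htop hg, ← mul_sum]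
  change _ - 2 * linkSum top s f g * linkSum top s f g +
    linkSum top s (fun u => f u ^ 2) g = _
  ring

theorem sum_linkSum_insert [Fintype U] (htop : ∀ g, (top g).card = d) (f : U → ℝ) :
    ∑ v with v ∉ s, ∑ g ∈ topsOver top (insert v s), linkSum top (insert v s) f g =
      ((d : ℝ) - s.card - 1) * ∑ g ∈ topsOver top s, linkSum top s f g := by
  rw [sum_link_vertices_tops, mul_sum]
  refine sum_congr rfl fun g hg => ?_
  rw [sum_congr rfl fun v hv => by rw [linkSum_insert hv f]]
  simp only [sum_sub_distrib, sum_const, nsmul_eq_mul]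
  rw [card_link_top htop hg]
  change _ - linkSum top s f g = _
  ring

/-- Local expansion for functions that need not have mean zero. -/
theorem IsLocalExpander.sum_sq_le {lam : ℝ} (h : IsLocalExpander top d s lam)
    (htop : ∀ g, (top g).card = d) (hs : s.card < d) (f : U → ℝ) :
    ∑ g ∈ topsOver top s, linkSum top s f g ^ 2 ≤
      (1 + lam * ((d : ℝ) - s.card - 1)) *
          ∑ g ∈ topsOver top s, linkSum top s (fun u => f u ^ 2) g +
        (1 - lam) * ((d : ℝ) - s.card - 1) * (∑ g ∈ topsOver top s, linkSum top s f g) ^ 2 /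
          (((d : ℝ) - s.card) * (topsOver top s).card) := by
  rcases (topsOver top s).eq_empty_or_nonempty with h0 | hne
  · simp [h0]
  have hN : (0 : ℝ) < (topsOver top s).card := by exact_mod_cast hne.card_pos
  have hn : (0 : ℝ) < (d : ℝ) - s.card := sub_pos.2 (by exact_mod_cast hs)
  set N : ℝ := ((topsOver top s).card : ℝ)
  set n : ℝ := (d : ℝ) - s.card with hn_def
  set M : ℝ := ∑ g ∈ topsOver top s, linkSum top s f g with hM
  set c : ℝ := M / (n * N) with hc
  have hS : ∀ g ∈ topsOver top s,
      linkSum top s (fun u => f u - c) g = linkSum top s f g - n * c := by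
    intro g hg
    rw [← linkSum_const htop hg c]
    exact sum_sub_distrib _ _
  have hD : ∀ g ∈ topsOver top s, linkSum top s (fun u => (f u - c) ^ 2) g =
      linkSum top s (fun u => f u ^ 2) g - 2 * c * linkSum top s f g + n * c ^ 2 := by
    intro g hg
    rw [← linkSum_const htop hg (c ^ 2)]
    simp only [linkSum, mul_sum]
    rw [← sum_sub_distrib, ← sum_add_distrib]
    exact sum_congr rfl fun u _ => by ring
  have hcM : n * N * c = M := by rw [hc]; field_simp
  have h1 := h (fun u => f u - c) (by
    rw [sum_congr rfl hS, sum_sub_distrib, sum_const, nsmul_eq_mul, ← hM]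
    linarith)
  have h2 : ∑ g ∈ topsOver top s, linkSum top s (fun u => f u - c) g ^ 2 =
      ∑ g ∈ topsOver top s, linkSum top s f g ^ 2 - n * c * M := by
    rw [sum_congr rfl fun g hg => by rw [hS g hg]]
    simp only [sub_sq, sum_add_distrib, sum_sub_distrib, sum_const, nsmul_eq_mul]
    rw [← sum_mul, ← mul_sum, ← hM, ← hcM]
    ring
  have h3 : ∑ g ∈ topsOver top s, linkSum top s (fun u => (f u - c) ^ 2) g =
      ∑ g ∈ topsOver top s, linkSum top s (fun u => f u ^ 2) g - c * M := by
    rw [sum_congr rfl hD, sum_add_distrib, sum_sub_distrib, sum_const, nsmul_eq_mul, ← mul_sum,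
      ← hM, ← hcM]
    ring
  rw [h2, h3] at h1
  have h4 : (1 - lam) * (n - 1) * M ^ 2 / (n * N) = (1 - lam) * (n - 1) * (c * M) := by
    rw [hc]; ring
  rw [h4]
  linarith

/-- The core of the trickling-down argument: Garland's decomposition of the quadratic form over the
links of the vertices turns their expansion into a quadratic inequality for the eigenvalues of
the walk on the link of `s`, whose solutions below `1` are at most `lam / (1 - lam)`. Connectivity
excludes the eigenvalue `1`. -/
theorem eigenvalue_le_of_local_expander [Fintype U] {lam μ : ℝ} (htop : ∀ g, (top g).card = d)
    (hs : s.card + 3 ≤ d) (hlam : lam < 1) (hconn : IsLinkConnected top s)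
    (hloc : ∀ v ∉ s, (topsOver top (insert v s)).Nonempty →
      IsLocalExpander top d (insert v s) lam) {f : U → ℝ}
    (hmean : ∑ g ∈ topsOver top s, linkSum top s f g = 0)
    (hne : ∃ g ∈ topsOver top s, ∃ u ∈ top g \ s, f u ≠ 0)
    (heig : ∀ v ∉ s, (topsOver top (insert v s)).Nonempty →
      ∑ g ∈ topsOver top (insert v s), linkSum top (insert v s) f g =
        μ * (((d : ℝ) - s.card - 1) * (topsOver top (insert v s)).card * f v)) :
    μ ≤ lam / (1 - lam) := by
  set n : ℝ := (d : ℝ) - s.card with hn_def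
  have hn : 3 ≤ n := by
    have : ((s.card + 3 : ℕ) : ℝ) ≤ d := by exact_mod_cast hs
    push_cast at this
    linarith
  set D : ℝ := ∑ g ∈ topsOver top s, linkSum top s (fun u => f u ^ 2) g with hD
  set L : ℝ := ∑ g ∈ topsOver top s, linkSum top s f g ^ 2 with hL
  have heig' : ∀ v ∉ s, ∑ g ∈ topsOver top (insert v s), linkSum top (insert v s) f g =
      μ * ((n - 1) * (topsOver top (insert v s)).card * f v) := by
    intro v hv
    rcases (topsOver top (insert v s)).eq_empty_or_nonempty with h0 | h0
    · simp [h0]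
    · exact heig v hv h0
  have hDpos : 0 < D := by
    obtain ⟨g, hg, u, hu, hfu⟩ := hne
    have h1 : 0 < linkSum top s (fun u => f u ^ 2) g :=
      sum_pos' (fun v _ => sq_nonneg _) ⟨u, hu, by positivity⟩
    exact sum_pos' (fun g _ => sum_nonneg fun v _ => sq_nonneg _) ⟨g, hg, h1⟩
  -- the weighted norm, vertex by vertex
  have hDsum : ∑ v with v ∉ s, ((topsOver top (insert v s)).card : ℝ) * f v ^ 2 = D :=
    sum_card_mul fun v => f v ^ 2
  have hLD : L = D + μ * (n - 1) * D := by
    have h := sum_mul_linkSum_insert (top := top) (s := s) f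
    rw [← hDsum, mul_sum, hDsum]
    rw [← hL, ← hD] at h
    rw [← sub_eq_iff_eq_add', ← h]
    refine sum_congr rfl fun v hv => ?_
    rw [heig' v (mem_filter.1 hv).2]
    ring
  have hquad : μ ≤ lam + (1 - lam) * μ ^ 2 := by
    have h1 := sum_linkSum_sq_insert (s := s) htop f
    have h2 := sum_linkSum_insert (s := s) htop fun u => f u ^ 2
    rw [← hL, ← hD] at h1
    rw [← hD] at h2
    have h3 : ∑ v with v ∉ s, ∑ g ∈ topsOver top (insert v s), linkSum top (insert v s) f g ^ 2 ≤
        ∑ v with v ∉ s, ((1 + lam * (n - 2)) *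
          ∑ g ∈ topsOver top (insert v s), linkSum top (insert v s) (fun u => f u ^ 2) g +
          (1 - lam) * (n - 2) * (n - 1) * μ ^ 2 *
            (((topsOver top (insert v s)).card : ℝ) * f v ^ 2)) := by
      refine sum_le_sum fun v hv => ?_
      have hv' := (mem_filter.1 hv).2
      rcases (topsOver top (insert v s)).eq_empty_or_nonempty with h0 | h0
      · simp [h0]
      have hN : (0 : ℝ) < (topsOver top (insert v s)).card := by exact_mod_cast h0.card_pos
      have hcard := card_insert_of_notMem hv'
      have h4 := (hloc v hv' h0).sum_sq_le htop (by omega) f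
      rw [heig' v hv', hcard] at h4
      push_cast at h4
      refine h4.trans_eq ?_
      have e1 : (d : ℝ) - (s.card + 1) - 1 = n - 2 := by rw [hn_def]; ring
      have e2 : (d : ℝ) - (s.card + 1) = n - 1 := by rw [hn_def]; ring
      rw [e1, e2]
      have e3 : n - 1 ≠ 0 := by linarith
      field_simp
    rw [h1, sum_add_distrib, ← mul_sum, ← mul_sum, h2, hDsum, hLD] at h3
    have h5 : ((n - 2) * (n - 1) * D) * μ ≤
        ((n - 2) * (n - 1) * D) * (lam + (1 - lam) * μ ^ 2) := by
      change (n - 2) * (D + μ * (n - 1) * D) + D ≤ _ at h3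
      change _ ≤ (1 + lam * (n - 2)) * ((n - 1) * D) + _ at h3
      linarith
    refine le_of_mul_le_mul_left h5 ?_
    have : 0 < n - 2 := by linarith
    have : 0 < n - 1 := by linarith
    positivity
  have hlt : μ < 1 := by
    by_contra hμ
    rw [not_lt] at hμ
    have hvar : ∀ g ∈ topsOver top s, ∑ u ∈ top g \ s, ∑ v ∈ top g \ s, (f u - f v) ^ 2 =
        2 * (n * linkSum top s (fun u => f u ^ 2) g - linkSum top s f g ^ 2) := by
      intro g hg
      simp only [sub_sq, sum_add_distrib, sum_sub_distrib, sum_const, nsmul_eq_mul, ← mul_sum,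
        ← sum_mul]
      rw [card_link_top htop hg]
      simp only [linkSum]
      ring
    have hzero : ∑ g ∈ topsOver top s, ∑ u ∈ top g \ s, ∑ v ∈ top g \ s, (f u - f v) ^ 2 = 0 := by
      refine le_antisymm ?_ (sum_nonneg fun g _ => sum_nonneg fun u _ => sum_nonneg fun v _ =>
        sq_nonneg _)
      rw [sum_congr rfl hvar, ← mul_sum, sum_sub_distrib, ← mul_sum, ← hL, ← hD, hLD]
      have : 0 ≤ (μ - 1) * ((n - 1) * D) :=
        mul_nonneg (by linarith) (mul_nonneg (by linarith) hDpos.le)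
      linarith
    obtain ⟨c, hc⟩ := hconn f fun g hg u hu v hv => by
      have h1 := (sum_eq_zero_iff_of_nonneg fun g _ => sum_nonneg fun u _ => sum_nonneg fun v _ =>
        sq_nonneg _).1 hzero g hg
      have h2 := (sum_eq_zero_iff_of_nonneg fun u _ => sum_nonneg fun v _ => sq_nonneg _).1 h1 u hu
      have h3 := (sum_eq_zero_iff_of_nonneg fun v _ => sq_nonneg _).1 h2 v hv
      exact sub_eq_zero.1 (pow_eq_zero_iff two_ne_zero |>.1 h3)
    have hfc : ∀ g ∈ topsOver top s, linkSum top s f g = n * c := by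
      intro g hg
      rw [← linkSum_const htop hg c]
      exact sum_congr rfl fun u hu => hc g hg u hu
    rw [sum_congr rfl hfc, sum_const, nsmul_eq_mul] at hmean
    obtain ⟨g, hg, u, hu, hfu⟩ := hne
    have hN : (0 : ℝ) < (topsOver top s).card := by exact_mod_cast card_pos.2 ⟨g, hg⟩
    have : c ≠ 0 := by rw [← hc g hg u hu]; exact hfu
    have : (topsOver top s).card * (n * c) ≠ 0 := by positivity
    exact this hmean
  rw [le_div_iff₀ (by linarith)]
  nlinarith

end LocalExpansion

/-! ### The random walk on the vertices of a link -/

section LinkWalk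

variable {Γ U : Type*} [Fintype Γ] [DecidableEq U]

/-- The symmetric edge weight of the walk on the link of `s`: the number of top faces that contain
`s`, `u` and `v`. -/
def linkEdgeCount (top : Γ → Finset U) (s : Finset U) (u v : U) : ℝ :=
  if u = v then 0 else ((topsOver top (insert v (insert u s))).card : ℝ)

/-- The vertex weight of the walk on the link of `s`, the row sum of `linkEdgeCount`. -/
def linkVertexCount (top : Γ → Finset U) (d : ℕ) (s : Finset U) (u : U) : ℝ :=
  ((d : ℝ) - s.card - 1) * ((topsOver top (insert u s)).card : ℝ)

variable {top : Γ → Finset U} {d : ℕ} {s : Finset U}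

theorem linkEdgeCount_comm (u v : U) : linkEdgeCount top s u v = linkEdgeCount top s v u := by
  simp only [linkEdgeCount, insert_comm v u, eq_comm]

theorem topsOver_insert_eq_empty {u v : U} (h : topsOver top (insert v s) = ∅) :
    topsOver top (insert v (insert u s)) = ∅ := by
  rw [← subset_empty, ← h]
  intro g hg
  rw [mem_topsOver] at hg ⊢
  exact (insert_subset_insert _ (subset_insert _ _)).trans hg

theorem linkVertexCount_pos {p : U → Prop}
    (hp : ∀ v, p v ↔ v ∉ s ∧ (topsOver top (insert v s)).Nonempty)
    (hs : s.card + 2 ≤ d) (u : {v // p v}) : 0 < linkVertexCount top d s u := by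
  have h1 : ((s.card + 2 : ℕ) : ℝ) ≤ d := by exact_mod_cast hs
  push_cast at h1
  have h2 : (0 : ℝ) < (topsOver top (insert u.1 s)).card := by
    exact_mod_cast ((hp u).1 u.2).2.card_pos
  exact mul_pos (by linarith) h2

/-- A function on the vertices of the link, extended by zero. -/
theorem exists_extension {U : Type*} {p : U → Prop} (f : {v // p v} → ℝ) :
    ∃ g : U → ℝ, ∀ v : {v // p v}, g v = f v := by
  classical
  exact ⟨fun v => if h : p v then f ⟨v, h⟩ else 0, fun v => by simp [v.2]⟩

variable [Fintype U] {p : U → Prop} [Fintype {v // p v}]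

theorem sum_link_vertices (hp : ∀ v, p v ↔ v ∉ s ∧ (topsOver top (insert v s)).Nonempty)
    (H : U → ℝ) (hH : ∀ v, topsOver top (insert v s) = ∅ → H v = 0) :
    ∑ v : {v // p v}, H v = ∑ v with v ∉ s, H v := by
  classical
  rw [← sum_subtype (univ.filter p) (fun v => by simp) H]
  refine sum_subset (fun v hv => ?_) fun v hv hv' => hH v ?_
  · simp only [mem_filter, mem_univ, true_and] at hv ⊢
    exact ((hp v).1 hv).1
  · simp only [mem_filter, mem_univ, true_and, hp, not_and, not_nonempty_iff_eq_empty] at hv hv'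
    exact hv' hv

theorem sum_linkEdgeCount_mul (hp : ∀ v, p v ↔ v ∉ s ∧ (topsOver top (insert v s)).Nonempty)
    (f : U → ℝ) {u : U} (hu : u ∉ s) :
    ∑ v : {v // p v}, linkEdgeCount top s u v * f v =
      ∑ g ∈ topsOver top (insert u s), linkSum top (insert u s) f g := by
  rw [sum_link_vertices hp (fun v => linkEdgeCount top s u v * f v), ← sum_card_mul]
  · have h : (univ.filter fun v => v ∉ s) = insert u (univ.filter fun v => v ∉ insert u s) := by
      ext v
      simp only [mem_filter, mem_univ, true_and, mem_insert, not_or]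
      by_cases h : v = u
      · simp [h, hu]
      · simp [h]
    rw [h, sum_insert (by simp)]
    have h0 : linkEdgeCount top s u u = 0 := if_pos rfl
    rw [h0, zero_mul, zero_add]
    refine sum_congr rfl fun v hv => ?_
    have hvu : u ≠ v := by
      rintro rfl
      simp at hv
    rw [linkEdgeCount, if_neg hvu]
  · intro v hv
    simp [linkEdgeCount, topsOver_insert_eq_empty hv]

theorem sum_linkEdgeCount (htop : ∀ g, (top g).card = d)
    (hp : ∀ v, p v ↔ v ∉ s ∧ (topsOver top (insert v s)).Nonempty) {u : U} (hu : u ∉ s) :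
    ∑ v : {v // p v}, linkEdgeCount top s u v = linkVertexCount top d s u := by
  have h := sum_linkEdgeCount_mul hp (fun _ => 1) hu
  simp only [mul_one] at h
  rw [h, sum_congr rfl fun g hg => linkSum_const htop hg 1, sum_const, nsmul_eq_mul,
    card_insert_of_notMem hu, linkVertexCount]
  push_cast
  ring

theorem linkWalk_sum (hp : ∀ v, p v ↔ v ∉ s ∧ (topsOver top (insert v s)).Nonempty)
    (f : U → ℝ) : ∑ v : {v // p v}, linkVertexCount top d s v * f v =
      ((d : ℝ) - s.card - 1) * ∑ g ∈ topsOver top s, linkSum top s f g := by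
  rw [sum_link_vertices hp (fun v => linkVertexCount top d s v * f v), ← sum_card_mul, mul_sum]
  · exact sum_congr rfl fun v _ => mul_assoc _ _ _
  · intro v hv
    simp [linkVertexCount, hv]

theorem linkWalk_form (hp : ∀ v, p v ↔ v ∉ s ∧ (topsOver top (insert v s)).Nonempty)
    (f : U → ℝ) :
    ∑ u : {v // p v}, ∑ v : {v // p v}, linkEdgeCount top s u v * f u * f v =
      ∑ g ∈ topsOver top s, linkSum top s f g ^ 2 -
        ∑ g ∈ topsOver top s, linkSum top s (fun u => f u ^ 2) g := by
  rw [← sum_mul_linkSum_insert, ← sum_link_vertices hp]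
  · refine sum_congr rfl fun u _ => ?_
    rw [← sum_linkEdgeCount_mul hp f ((hp u).1 u.2).1, mul_sum]
    exact sum_congr rfl fun v _ => by ring
  · intro v hv
    rw [hv, sum_empty, mul_zero]

/-- Oppenheim's trickling-down theorem. -/
theorem IsLocalExpander.trickle_down {lam : ℝ} (htop : ∀ g, (top g).card = d)
    (hs : s.card + 3 ≤ d) (hlam : lam < 1) (hconn : IsLinkConnected top s)
    (hloc : ∀ v ∉ s, (topsOver top (insert v s)).Nonempty →
      IsLocalExpander top d (insert v s) lam) :
    IsLocalExpander top d s (lam / (1 - lam)) := by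
  classical
  intro f hf
  set p : U → Prop := fun v => v ∉ s ∧ (topsOver top (insert v s)).Nonempty
  have hp : ∀ v, p v ↔ v ∉ s ∧ (topsOver top (insert v s)).Nonempty := fun _ => Iff.rfl
  have hpos := linkVertexCount_pos hp (by omega : s.card + 2 ≤ d)
  have h := quadratic_bound_of_eigenvalue_bound
    (W := fun u v : {v // p v} => linkEdgeCount top s u v) (fun u v => linkEdgeCount_comm _ _)
    (m := fun u => linkVertexCount top d s u) hpos (fun u => sum_linkEdgeCount htop hp u.2.1)
    (lam := lam / (1 - lam)) ?_ (fun v => f v) (by rw [linkWalk_sum hp, hf, mul_zero])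
  · rw [linkWalk_form hp, linkWalk_sum hp (fun v => f v ^ 2)] at h
    linarith
  · intro μ φ hne hmean heig
    obtain ⟨g, hg⟩ := exists_extension φ
    have hn : (0 : ℝ) < (d : ℝ) - s.card - 1 := by
      have h1 : ((s.card + 3 : ℕ) : ℝ) ≤ d := by exact_mod_cast hs
      push_cast at h1
      linarith
    simp only [← hg] at hmean heig
    rw [linkWalk_sum hp] at hmean
    refine eigenvalue_le_of_local_expander htop hs hlam hconn hloc (f := g)
      ((mul_eq_zero.1 hmean).resolve_left hn.ne') ?_ fun v hv hv' => ?_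
    · obtain ⟨v, hv⟩ := Function.ne_iff.1 hne
      obtain ⟨T, hT⟩ := v.2.2
      rw [mem_topsOver, insert_subset_iff] at hT
      exact ⟨T, mem_topsOver.2 hT.2, v, mem_sdiff.2 ⟨hT.1, v.2.1⟩, by rw [hg]; exact hv⟩
    · rw [← sum_linkEdgeCount_mul hp g hv]
      exact heig ⟨v, hv, hv'⟩

/-- A local expander with `d - |s|` vertices in each top face of the link is a two-sided spectral
expander: the smallest eigenvalue is at least `-1 / (d - |s| - 1)`, because the sum of the squares
of the sums over top faces is nonnegative. -/
theorem IsLocalExpander.exists_eigenvalues [DecidableEq {v // p v}] {lam : ℝ}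
    (h : IsLocalExpander top d s lam) (htop : ∀ g, (top g).card = d)
    (hp : ∀ v, p v ↔ v ∉ s ∧ (topsOver top (insert v s)).Nonempty)
    (hs : s.card + 2 ≤ d) (hne : (topsOver top s).Nonempty)
    (hlow : 1 / ((d : ℝ) - s.card - 1) ≤ lam) :
    ∃ (n : ℕ) (ev : Fin (n + 2) → ℝ), Antitone ev ∧
      Matrix.charpoly (fun u v => linkEdgeCount top s u v / linkVertexCount top d s u :
        Matrix {v // p v} {v // p v} ℝ) = ∏ i, (Polynomial.X - Polynomial.C (ev i)) ∧
      max (ev 1) |ev (Fin.last (n + 1))| ≤ lam := by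
  have hn : (0 : ℝ) < (d : ℝ) - s.card - 1 := by
    have h1 : ((s.card + 2 : ℕ) : ℝ) ≤ d := by exact_mod_cast hs
    push_cast at h1
    linarith
  refine exists_eigenvalues_of_quadratic_bounds (W := fun u v : {v // p v} =>
    linkEdgeCount top s u v) (fun u v => linkEdgeCount_comm _ _)
    (m := fun u => linkVertexCount top d s u) (linkVertexCount_pos hp hs) ?_ ?_ ?_
  · obtain ⟨g, hg⟩ := hne
    have hcard := card_sdiff_add_card_eq_card (mem_topsOver.1 hg)
    rw [htop] at hcard
    have hlink : ∀ v ∈ top g \ s, p v := fun v hv => by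
      rw [mem_sdiff] at hv
      exact (hp v).2 ⟨hv.2, g, mem_topsOver.2 (insert_subset hv.1 (mem_topsOver.1 hg))⟩
    have h2 : ((top g \ s).attach.image fun v => (⟨v.1, hlink v.1 v.2⟩ : {v // p v})).card =
        (top g \ s).card := by
      rw [card_image_of_injective, card_attach]
      intro v w hvw
      exact Subtype.ext (congrArg (fun x : {v // p v} => x.1) hvw)
    have h3 := card_le_univ
      ((top g \ s).attach.image fun v => (⟨v.1, hlink v.1 v.2⟩ : {v // p v}))
    omega
  · intro f hf
    obtain ⟨g, hg⟩ := exists_extension f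
    simp only [← hg] at hf ⊢
    rw [linkWalk_sum hp] at hf
    have h1 := h g ((mul_eq_zero.1 hf).resolve_left hn.ne')
    rw [linkWalk_form hp, linkWalk_sum hp (fun v => g v ^ 2)]
    linarith
  · intro f
    obtain ⟨g, hg⟩ := exists_extension f
    simp only [← hg]
    rw [linkWalk_form hp, linkWalk_sum hp (fun v => g v ^ 2)]
    have hS : 0 ≤ ∑ T ∈ topsOver top s, linkSum top s g T ^ 2 := sum_nonneg fun _ _ => sq_nonneg _
    have hD : 0 ≤ ∑ T ∈ topsOver top s, linkSum top s (fun u => g u ^ 2) T :=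
      sum_nonneg fun _ _ => sum_nonneg fun _ _ => sq_nonneg _
    rw [div_le_iff₀ hn] at hlow
    have := mul_le_mul_of_nonneg_right hlow hD
    linarith

end LinkWalk

/-! ### The weighted complex of a family of top faces -/

section UniformComplex

variable {Γ U : Type*} {X : SComplex U} {top : Γ → Finset U} {d : ℕ}

theorem card_le_of_mem_faces (hX : ∀ σ, σ ∈ X.faces ↔ ∃ g, σ ⊆ top g)
    (htop : ∀ g, (top g).card = d) {σ : Finset U} (hσ : σ ∈ X.faces) : σ.card ≤ d := by
  obtain ⟨g, hg⟩ := (hX σ).1 hσ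
  exact (card_le_card hg).trans_eq (htop g)

theorem skeleton_isPureOfDim (hX : ∀ σ, σ ∈ X.faces ↔ ∃ g, σ ⊆ top g)
    (htop : ∀ g, (top g).card = d) [Nonempty Γ] {k : ℕ} (hk : k < d) :
    (X.skeleton k).IsPureOfDim k := by
  have h : ∀ σ ∈ (X.skeleton k).faces, ∃ T ∈ (X.skeleton k).faces, σ ⊆ T ∧ T.card = k + 1 := by
    rintro σ ⟨hσ, hc⟩
    obtain ⟨g, hg⟩ := (hX σ).1 hσ
    obtain ⟨T, h1, h2, h3⟩ := exists_subsuperset_card_eq hg hc (by rw [htop]; omega)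
    exact ⟨T, ⟨(hX T).2 ⟨g, h2⟩, h3.le⟩, h1, h3⟩
  refine ⟨?_, h⟩
  obtain ⟨g⟩ := ‹Nonempty Γ›
  obtain ⟨T, hT, -, hc⟩ := h ∅ ⟨(hX ∅).2 ⟨g, empty_subset _⟩, by simp⟩
  exact ⟨T, hT, hc⟩

open Classical in
theorem mem_link_skeleton_iff {k : ℕ} {s τ : Finset U} (hd : Disjoint s τ) :
    τ ∈ ((X.skeleton k).link s).faces ↔ s ∪ τ ∈ X.faces ∧ (s ∪ τ).card ≤ k + 1 := by
  constructor
  · rintro ⟨T, hT, hsT, rfl⟩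
    rw [union_sdiff_of_subset hsT]
    exact hT
  · intro h
    refine ⟨s ∪ τ, h, subset_union_left, ?_⟩
    rw [union_sdiff_left, sdiff_eq_self_of_disjoint hd.symm]

/-- The link of the empty face is the complex itself, with its weight. -/
theorem isSpectralExpander_of_isSpectralHDX {U : Type*} [Fintype U] {X : SComplex U}
    {w : Finset U → ℝ} {lam : ℝ} (hw : w ∅ = 1)
    (he : ∅ ∈ X.faces) (h : (X.skeleton 1).IsSpectralHDX w 1 lam) :
    (X.skeleton 1).IsSpectralExpander w lam := by
  classical
  have h1 := h.2.2 ∅ ⟨he, by simp⟩ (by simp)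
  have h2 : ((X.skeleton 1).link ∅).skeleton 1 = X.skeleton 1 := by
    have : (((X.skeleton 1).link ∅).skeleton 1).faces = (X.skeleton 1).faces := by
      ext τ
      constructor
      · rintro ⟨⟨T, hT, -, rfl⟩, -⟩
        rwa [sdiff_empty]
      · intro hτ
        exact ⟨⟨τ, hτ, empty_subset _, by rw [sdiff_empty]⟩, hτ.2⟩
    generalize ((X.skeleton 1).link ∅).skeleton 1 = Y at this
    generalize X.skeleton 1 = Z at this
    cases Y
    cases Z
    simpa using this
  have h3 : SComplex.linkWeight w ∅ = w := by
    ext τ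
    simp [SComplex.linkWeight, hw]
  rwa [h2, h3] at h1

variable [Fintype Γ]

open Classical in
theorem topsOver_empty : topsOver top ∅ = univ := by
  ext g
  simp [mem_topsOver]

open Classical in
theorem mem_faces_iff (hX : ∀ σ, σ ∈ X.faces ↔ ∃ g, σ ⊆ top g) (σ : Finset U) :
    σ ∈ X.faces ↔ (topsOver top σ).Nonempty := by
  rw [hX]
  exact ⟨fun ⟨g, hg⟩ => ⟨g, mem_topsOver.2 hg⟩, fun ⟨g, hg⟩ => ⟨g, mem_topsOver.1 hg⟩⟩

open Classical in
theorem singleton_mem_link_skeleton (hX : ∀ σ, σ ∈ X.faces ↔ ∃ g, σ ⊆ top g) {k : ℕ}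
    {s : Finset U} (hk : s.card + 1 ≤ k) (v : U) :
    {v} ∈ (((X.skeleton k).link s).skeleton 1).faces ↔
      v ∉ s ∧ (topsOver top (insert v s)).Nonempty := by
  have hu : s ∪ {v} = insert v s := by rw [union_comm]; rfl
  by_cases hv : v ∈ s
  · refine iff_of_false ?_ fun h => h.1 hv
    rintro ⟨⟨T, hT, hsT, h⟩, -⟩
    have : v ∈ T \ s := h ▸ mem_singleton_self v
    exact (mem_sdiff.1 this).2 hv
  · have hc := card_insert_of_notMem hv
    have h := mem_link_skeleton_iff (X := X) (k := k) (disjoint_singleton_right.2 hv)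
    rw [hu, mem_faces_iff hX] at h
    constructor
    · exact fun h1 => ⟨hv, (h.1 h1.1).1⟩
    · exact fun h1 => ⟨h.2 ⟨h1.2, by omega⟩, by simp⟩

variable [Fintype U]

open Classical in
theorem uniformWeight_eq (hX : ∀ σ, σ ∈ X.faces ↔ ∃ g, σ ⊆ top g)
    (htop : ∀ g, (top g).card = d) (hinj : Function.Injective top) (σ : Finset U) :
    X.uniformWeight d σ =
      (topsOver top σ).card / ((Fintype.card Γ : ℝ) * (d.choose σ.card : ℝ)) := by
  have key : ∀ σ : Finset U,
      (univ.filter fun T : Finset U => T ∈ X.faces ∧ T.card = d ∧ σ ⊆ T).card =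
        (topsOver top σ).card := by
    intro σ
    rw [← card_image_of_injective _ hinj]
    congr 1
    ext T
    simp only [mem_filter, mem_univ, true_and, mem_image, mem_topsOver, hX]
    constructor
    · rintro ⟨⟨g, hg⟩, hc, hσ⟩
      have : T = top g := eq_of_subset_of_card_le hg (by rw [htop, hc])
      exact ⟨g, this ▸ hσ, this.symm⟩
    · rintro ⟨g, hg, rfl⟩
      exact ⟨⟨g, Subset.rfl⟩, htop g, hg⟩
  have h0 := key ∅
  simp only [empty_subset, and_true] at h0
  rw [SComplex.uniformWeight, key, h0, topsOver_empty, card_univ]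

open Classical in
theorem uniformWeight_eq_zero (hX : ∀ σ, σ ∈ X.faces ↔ ∃ g, σ ⊆ top g)
    (htop : ∀ g, (top g).card = d) (hinj : Function.Injective top) {σ : Finset U}
    (hσ : σ ∉ X.faces) : X.uniformWeight d σ = 0 := by
  rw [mem_faces_iff hX, not_nonempty_iff_eq_empty] at hσ
  rw [uniformWeight_eq hX htop hinj, hσ]
  simp

theorem uniformWeight_pos (hX : ∀ σ, σ ∈ X.faces ↔ ∃ g, σ ⊆ top g)
    (htop : ∀ g, (top g).card = d) (hinj : Function.Injective top) {σ : Finset U}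
    (hσ : σ ∈ X.faces) : 0 < X.uniformWeight d σ := by
  classical
  have h1 : 0 < (d.choose σ.card : ℝ) := by
    exact_mod_cast Nat.choose_pos (card_le_of_mem_faces hX htop hσ)
  have h3 := (mem_faces_iff hX σ).1 hσ
  have h2 : 0 < (Fintype.card Γ : ℝ) := by
    obtain ⟨g, -⟩ := h3
    exact_mod_cast Fintype.card_pos_iff.2 ⟨g⟩
  have h4 : 0 < ((topsOver top σ).card : ℝ) := by exact_mod_cast h3.card_pos
  rw [uniformWeight_eq hX htop hinj]
  positivity

theorem sum_uniformWeight (hX : ∀ σ, σ ∈ X.faces ↔ ∃ g, σ ⊆ top g)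
    (htop : ∀ g, (top g).card = d) (hinj : Function.Injective top) [Nonempty Γ] {m : ℕ}
    (hm : m ≤ d) : ∑ σ ∈ powersetCard m univ, X.uniformWeight d σ = 1 := by
  classical
  have h1 : ∑ σ ∈ powersetCard m (univ : Finset U), ((topsOver top σ).card : ℝ) =
      Fintype.card Γ * d.choose m := by
    have h2 : ∑ σ ∈ powersetCard m (univ : Finset U), ∑ g ∈ topsOver top σ, (1 : ℝ) =
        ∑ g : Γ, ∑ σ ∈ powersetCard m (top g), (1 : ℝ) := by
      refine sum_comm' fun σ g => ?_
      simp only [mem_powersetCard, mem_topsOver, mem_univ, subset_univ, true_and]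
      tauto
    simpa [htop] using h2
  have h3 : (0 : ℝ) < d.choose m := by exact_mod_cast Nat.choose_pos hm
  have h4 : (0 : ℝ) < Fintype.card Γ := by exact_mod_cast Fintype.card_pos
  calc ∑ σ ∈ powersetCard m univ, X.uniformWeight d σ
      = ∑ σ ∈ powersetCard m (univ : Finset U),
          ((topsOver top σ).card : ℝ) / ((Fintype.card Γ : ℝ) * d.choose m) := by
        refine sum_congr rfl fun σ hσ => ?_
        rw [uniformWeight_eq hX htop hinj, (mem_powersetCard.1 hσ).2]
    _ = 1 := by
        rw [← sum_div, h1]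
        field_simp

open Classical in
theorem sum_uniformWeight_over (hX : ∀ σ, σ ∈ X.faces ↔ ∃ g, σ ⊆ top g)
    (htop : ∀ g, (top g).card = d) (hinj : Function.Injective top) {σ : Finset U}
    (hσ : σ ∈ X.faces) (hc : σ.card < d) :
    ∑ τ : Finset U with σ ⊆ τ ∧ τ.card = σ.card + 1, X.uniformWeight d τ =
      (σ.card + 1) * X.uniformWeight d σ := by
  have h1 : ∑ τ : Finset U with σ ⊆ τ ∧ τ.card = σ.card + 1, X.uniformWeight d τ =
      ∑ v with v ∉ σ, X.uniformWeight d (insert v σ) := by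
    symm
    refine sum_nbij (fun v => insert v σ) ?_ ?_ ?_ fun _ _ => rfl
    · intro v hv
      have hv' : v ∉ σ := by simpa using hv
      simp [card_insert_of_notMem hv']
    · intro v hv w hw hvw
      have hv' : v ∉ σ := by simpa using hv
      have : v ∈ insert w σ := by
        rw [← show insert v σ = insert w σ from hvw]
        exact mem_insert_self _ _
      exact (mem_insert.1 this).resolve_right hv'
    · intro τ hτ
      have hτ' : σ ⊆ τ ∧ τ.card = σ.card + 1 := by simpa using hτ
      obtain ⟨v, hv, rfl⟩ := exists_eq_insert_iff.2 ⟨hτ'.1, hτ'.2.symm⟩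
      exact ⟨v, by simpa using hv, rfl⟩
  have h2 : ∑ v with v ∉ σ, ((topsOver top (insert v σ)).card : ℝ) =
      (topsOver top σ).card * ((d : ℝ) - σ.card) := by
    have h := sum_card_mul (top := top) (s := σ) fun _ => 1
    simp only [mul_one] at h
    rw [h, sum_congr rfl fun g hg => linkSum_const htop hg 1, sum_const, nsmul_eq_mul, mul_one]
  have h3 : (d.choose (σ.card + 1) : ℝ) * (σ.card + 1) = d.choose σ.card * ((d : ℝ) - σ.card) := by
    rw [← Nat.cast_sub hc.le]
    exact_mod_cast Nat.choose_succ_right_eq d σ.card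
  have h4 : (0 : ℝ) < d.choose (σ.card + 1) := by exact_mod_cast Nat.choose_pos hc
  have h5 : (0 : ℝ) < d.choose σ.card := by exact_mod_cast Nat.choose_pos hc.le
  have h6 : (0 : ℝ) < Fintype.card Γ := by
    obtain ⟨g, -⟩ := (hX σ).1 hσ
    exact_mod_cast Fintype.card_pos_iff.2 ⟨g⟩
  calc _ = ∑ v with v ∉ σ, ((topsOver top (insert v σ)).card : ℝ) /
          ((Fintype.card Γ : ℝ) * d.choose (σ.card + 1)) := by
        rw [h1]
        refine sum_congr rfl fun v hv => ?_
        rw [uniformWeight_eq hX htop hinj, card_insert_of_notMem (mem_filter.1 hv).2]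
    _ = _ := by
        rw [← sum_div, h2, uniformWeight_eq hX htop hinj, div_eq_iff (by positivity)]
        field_simp
        linear_combination (-((topsOver top σ).card : ℝ)) * h3

theorem skeleton_isWeighted (hX : ∀ σ, σ ∈ X.faces ↔ ∃ g, σ ⊆ top g)
    (htop : ∀ g, (top g).card = d) (hinj : Function.Injective top) [Nonempty Γ] {k : ℕ}
    (hk : k < d) : (X.skeleton k).IsWeighted (X.uniformWeight d) k := by
  classical
  refine ⟨skeleton_isPureOfDim hX htop hk,
    fun σ hσ => (uniformWeight_pos hX htop hinj hσ.1).le, ?_, fun σ hσ hc => ?_⟩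
  · rw [← sum_uniformWeight hX htop hinj (by omega : k + 1 ≤ d)]
    refine sum_subset (fun σ hσ => ?_) fun σ hσ hσ' => ?_
    · simp only [mem_filter, mem_univ, true_and] at hσ
      simp [hσ.2]
    · refine uniformWeight_eq_zero hX htop hinj fun hf => hσ' ?_
      have hc := (mem_powersetCard.1 hσ).2
      simp only [mem_filter, mem_univ, true_and]
      exact ⟨⟨hf, hc.le⟩, hc⟩
  · have h := sum_uniformWeight_over hX htop hinj hσ.1 (by omega)
    have h1 : ∑ τ : Finset U with τ ∈ (X.skeleton k).faces ∧ σ ⊆ τ ∧ τ.card = σ.card + 1,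
        X.uniformWeight d τ =
        ∑ τ : Finset U with σ ⊆ τ ∧ τ.card = σ.card + 1, X.uniformWeight d τ := by
      refine sum_subset (fun τ hτ => ?_) fun τ hτ hτ' => ?_
      · simp only [mem_filter, mem_univ, true_and] at hτ ⊢
        exact hτ.2
      · refine uniformWeight_eq_zero hX htop hinj fun hf => hτ' ?_
        simp only [mem_filter, mem_univ, true_and] at hτ ⊢
        exact ⟨⟨hf, by omega⟩, hτ⟩
    rw [h1, h]
    have : (σ.card : ℝ) + 1 ≠ 0 := by positivity
    field_simp

open Classical in
/-- The transition matrix of the walk on the link of `s`, by counting top faces. -/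
theorem adjMatrix_link_skeleton (hX : ∀ σ, σ ∈ X.faces ↔ ∃ g, σ ⊆ top g)
    (htop : ∀ g, (top g).card = d) (hinj : Function.Injective top) {k : ℕ} (hkd : k < d)
    {s : Finset U} (hs : s ∈ X.faces) (hk : s.card + 1 ≤ k) :
    (((X.skeleton k).link s).skeleton 1).adjMatrix (SComplex.linkWeight (X.uniformWeight d) s) =
      fun u v => linkEdgeCount top s u.1 v.1 / linkVertexCount top d s u.1 := by
  ext ⟨u, hu⟩ ⟨v, hv⟩
  have hu' := (singleton_mem_link_skeleton hX hk u).1 hu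
  have hv' := (singleton_mem_link_skeleton hX hk v).1 hv
  simp only [SComplex.adjMatrix, linkEdgeCount, ne_eq, Subtype.mk.injEq]
  by_cases huv : u = v
  · simp [huv]
  have hdis : Disjoint s {u, v} := by
    rw [disjoint_insert_right, disjoint_singleton_right]
    exact ⟨hu'.1, hv'.1⟩
  have hun : s ∪ {u, v} = insert v (insert u s) := by
    ext x
    simp only [mem_union, mem_insert, mem_singleton]
    tauto
  have hun1 : s ∪ {u} = insert u s := by rw [union_comm]; rfl
  have hc1 : (insert u s).card = s.card + 1 := card_insert_of_notMem hu'.1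
  have hc2 : (insert v (insert u s)).card = s.card + 2 := by
    rw [card_insert_of_notMem, hc1]
    rw [mem_insert, not_or]
    exact ⟨fun h => huv h.symm, hv'.1⟩
  by_cases hf : (topsOver top (insert v (insert u s))).Nonempty
  · have hedge : ({u, v} : Finset U) ∈ (((X.skeleton k).link s).skeleton 1).faces := by
      refine ⟨(mem_link_skeleton_iff hdis).2 ?_, card_le_two⟩
      rw [hun, mem_faces_iff hX, hc2]
      exact ⟨hf, by omega⟩
    rw [if_pos ⟨huv, hedge⟩, if_neg huv]
    have hw := uniformWeight_pos hX htop hinj hs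
    rw [SComplex.linkWeight, SComplex.linkWeight, hun, hun1, uniformWeight_eq hX htop hinj
      (insert v (insert u s)), uniformWeight_eq hX htop hinj (insert u s), hc1, hc2, card_pair huv,
      card_singleton, linkVertexCount]
    have hN : (0 : ℝ) < (topsOver top (insert u s)).card := by exact_mod_cast hu'.2.card_pos
    have h1 : (0 : ℝ) < d.choose (s.card + 1) := by exact_mod_cast Nat.choose_pos (by omega)
    have h2 : (0 : ℝ) < d.choose (s.card + 2) := by exact_mod_cast Nat.choose_pos (by omega)
    have h3 : (0 : ℝ) < Fintype.card Γ := by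
      obtain ⟨g, -⟩ := hf
      exact_mod_cast Fintype.card_pos_iff.2 ⟨g⟩
    have h4 : ((s.card + 1).choose s.card : ℝ) = s.card + 1 := by
      rw [Nat.choose_succ_self_right]
      push_cast
      ring
    have h5 : ((s.card + 2).choose s.card : ℝ) = (s.card + 2) * (s.card + 1) / 2 := by
      rw [Nat.choose_symm_add, Nat.cast_choose_two]
      push_cast
      ring
    have h6 : (d.choose (s.card + 2) : ℝ) * (s.card + 2) =
        d.choose (s.card + 1) * ((d : ℝ) - s.card - 1) := by
      have h7 := Nat.choose_succ_right_eq d (s.card + 1)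
      have h8 : ((d - (s.card + 1) : ℕ) : ℝ) = (d : ℝ) - s.card - 1 := by
        rw [Nat.cast_sub (by omega)]
        push_cast
        ring
      rw [← h8]
      exact_mod_cast h7
    have h9 : (0 : ℝ) < (d : ℝ) - s.card - 1 := by
      have : ((s.card + 2 : ℕ) : ℝ) ≤ d := by exact_mod_cast (by omega : s.card + 2 ≤ d)
      push_cast at this
      linarith
    rw [h4, h5]
    generalize X.uniformWeight d s = w at *
    generalize (d : ℝ) - s.card - 1 = n at *
    field_simp
    linear_combination -h6
  · have hnot : ¬ ({u, v} : Finset U) ∈ (((X.skeleton k).link s).skeleton 1).faces := by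
      intro h
      have := ((mem_link_skeleton_iff hdis).1 h.1).1
      rw [hun, mem_faces_iff hX] at this
      exact hf this
    rw [if_neg fun h => hnot h.2, if_neg huv, not_nonempty_iff_eq_empty.1 hf]
    simp

open Classical in
/-- Local expansion of the links gives two-sided spectral expansion of the skeleta. The term
`1 / (d - k)` accounts for the negative eigenvalues, which are at least `-1 / (d - |s| - 1)`. -/
theorem skeleton_isSpectralHDX (hX : ∀ σ, σ ∈ X.faces ↔ ∃ g, σ ⊆ top g)
    (htop : ∀ g, (top g).card = d) (hinj : Function.Injective top) [Nonempty Γ] {k : ℕ}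
    (hk : 1 ≤ k) (hkd : k < d) {lam : ℝ} (hlam : 1 / ((d : ℝ) - k) ≤ lam)
    (hexp : ∀ s ∈ X.faces, s.card + 1 ≤ k → IsLocalExpander top d s lam) :
    (X.skeleton k).IsSpectralHDX (X.uniformWeight d) k lam := by
  refine ⟨hk, skeleton_isWeighted hX htop hinj hkd, fun s hs hc => ?_⟩
  have hlow : 1 / ((d : ℝ) - s.card - 1) ≤ lam := by
    refine le_trans (one_div_le_one_div_of_le ?_ ?_) hlam
    · exact sub_pos.2 (by exact_mod_cast hkd)
    · have : ((s.card + 1 : ℕ) : ℝ) ≤ k := by exact_mod_cast hc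
      push_cast at this
      linarith
  have h := (hexp s hs.1 hc).exists_eigenvalues htop (singleton_mem_link_skeleton hX hc)
    (by omega) ((mem_faces_iff hX s).1 hs.1) hlow
  rw [SComplex.IsSpectralExpander, adjMatrix_link_skeleton hX htop hinj hkd hs.1 hc]
  exact h

end UniformComplex

/-! ### Fourier analysis on finite abelian groups -/

section Fourier

variable {V I : Type*} [AddCommGroup V] [Fintype V] [Fintype I]

open Classical in
/-- The sum of the autocorrelations of `f` at the points `k i`, in Fourier space. -/
theorem fourier_autocorrelation (k : I → V) (f : V → ℝ) :
    ∑ ψ : AddChar V ℂ, ((‖∑ v, (f v : ℂ) * ψ v‖ ^ 2 : ℝ) : ℂ) * ∑ i, ψ (k i) =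
      ((Fintype.card V * ∑ i, ∑ v, f (v + k i) * f v : ℝ) : ℂ) := by
  have h1 : ∀ ψ : AddChar V ℂ, ((‖∑ v, (f v : ℂ) * ψ v‖ ^ 2 : ℝ) : ℂ) * ∑ i, ψ (k i) =
      ∑ i, ∑ v, ∑ w, (f w : ℂ) * f v * ψ (v + k i - w) := by
    intro ψ
    have h2 : ((‖∑ v, (f v : ℂ) * ψ v‖ ^ 2 : ℝ) : ℂ) =
        (∑ v, (f v : ℂ) * ψ v) * ∑ w, (f w : ℂ) * ψ (-w) := by
      have h3 : ∑ w, (f w : ℂ) * ψ (-w) = (starRingEnd ℂ) (∑ v, (f v : ℂ) * ψ v) := by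
        rw [map_sum]
        refine sum_congr rfl fun w _ => ?_
        rw [map_mul, Complex.conj_ofReal, AddChar.map_neg_eq_conj]
      rw [h3, Complex.mul_conj, Complex.normSq_eq_norm_sq]
    rw [h2, mul_sum]
    refine sum_congr rfl fun i _ => ?_
    rw [sum_mul_sum, sum_mul]
    refine sum_congr rfl fun v _ => ?_
    rw [sum_mul]
    refine sum_congr rfl fun w _ => ?_
    rw [sub_eq_add_neg, AddChar.map_add_eq_mul, AddChar.map_add_eq_mul]
    ring
  simp only [h1]
  rw [sum_comm]
  push_cast
  rw [mul_sum]
  refine sum_congr rfl fun i _ => ?_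
  rw [sum_comm, mul_sum]
  refine sum_congr rfl fun v _ => ?_
  rw [sum_comm]
  simp only [← mul_sum, AddChar.sum_apply_eq_ite]
  simp only [sub_eq_zero, mul_ite, mul_zero, Fintype.sum_ite_eq]
  ring

/-- If the sum of every nontrivial character over the points `k i` is at most `B`, then `B` bounds
the convolution operator with these points on functions of mean zero. -/
theorem sum_autocorrelation_le (k : I → V) {B : ℝ}
    (hB : ∀ ψ : AddChar V ℂ, ψ ≠ 0 → ‖∑ i, ψ (k i)‖ ≤ B) {f : V → ℝ} (hf : ∑ v, f v = 0) :
    ∑ i, ∑ v, f (v + k i) * f v ≤ B * ∑ v, f v ^ 2 := by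
  classical
  have h1 := congrArg Complex.re (fourier_autocorrelation k f)
  have h2 := congrArg Complex.re (fourier_autocorrelation (fun _ : Unit => (0 : V)) f)
  rw [Complex.re_sum, Complex.ofReal_re] at h1 h2
  simp only [univ_unique, sum_singleton, add_zero, AddChar.map_zero_eq_one, mul_one,
    Complex.ofReal_re, ← sq] at h2
  simp only [Complex.re_ofReal_mul] at h1
  have h3 : ∑ ψ : AddChar V ℂ, ‖∑ v, (f v : ℂ) * ψ v‖ ^ 2 * (∑ i, ψ (k i)).re ≤
      ∑ ψ : AddChar V ℂ, ‖∑ v, (f v : ℂ) * ψ v‖ ^ 2 * B := by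
    refine sum_le_sum fun ψ _ => ?_
    by_cases hψ : ψ = 0
    · have : ∑ v, (f v : ℂ) * ψ v = 0 := by
        simp only [hψ, AddChar.zero_apply, mul_one]
        exact_mod_cast hf
      simp [this]
    · exact mul_le_mul_of_nonneg_left ((Complex.re_le_norm _).trans (hB ψ hψ)) (sq_nonneg _)
  rw [h1, ← sum_mul, h2] at h3
  have hpos : (0 : ℝ) < Fintype.card V := by exact_mod_cast Fintype.card_pos
  refine le_of_mul_le_mul_left ?_ hpos
  linarith

end Fourier

/-! ### The bilinear form of a Heisenberg group -/

section Heisenberg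

variable {F A B C : Type*} [Field F] [Fintype F] [AddCommGroup A] [Module F A]
  [AddCommGroup B] [Module F B] [Fintype B] [AddCommGroup C] (κ : A →+ B →+ C)

/-- A balanced pairing whose values generate `C` has at most `|B| / |F|` elements `b` for which a
given nontrivial character of `C` is trivial on all `κ a b`: they form a proper subspace. -/
theorem card_degenerate_le (hbal : ∀ (r : F) a b, κ (r • a) b = κ a (r • b))
    (hspan : AddSubgroup.closure {c | ∃ a b, κ a b = c} = ⊤) {γ : AddChar C ℂ} (hγ : γ ≠ 0)
    [DecidablePred fun b => ∀ a, γ (κ a b) = 1] :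
    (Fintype.card F : ℝ) * ((univ.filter fun b => ∀ a, γ (κ a b) = 1).card : ℝ) ≤
      Fintype.card B := by
  classical
  set S : Submodule F B :=
    { carrier := {b | ∀ a, γ (κ a b) = 1}
      zero_mem' := fun a => by simp
      add_mem' := fun {b b'} hb hb' a => by
        rw [map_add, AddChar.map_add_eq_mul, hb a, hb' a, one_mul]
      smul_mem' := fun r b hb a => by rw [← hbal]; exact hb _ } with hS
  have hne : S ≠ ⊤ := by
    intro htop
    refine hγ (DFunLike.ext _ _ fun c => ?_)
    have hc : c ∈ AddSubgroup.closure {c | ∃ a b, κ a b = c} := hspan ▸ AddSubgroup.mem_top c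
    induction hc using AddSubgroup.closure_induction with
    | mem c hc =>
      obtain ⟨a, b, rfl⟩ := hc
      have : b ∈ S := htop ▸ Submodule.mem_top
      exact this a
    | zero => simp
    | add x y _ _ hx hy =>
      rw [AddChar.map_add_eq_mul, hx, hy]
      simp
    | neg x _ hx =>
      rw [AddChar.map_neg_eq_inv, hx]
      simp
  have hcard : Nat.card B = Nat.card S * Nat.card (B ⧸ S) := by
    rw [Submodule.card_eq_card_quotient_mul_card S, mul_comm]
  have hS' : (univ.filter fun b => ∀ a, γ (κ a b) = 1).card = Nat.card S := by
    rw [Nat.card_eq_fintype_card, Fintype.card_subtype]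
    congr 1
    ext b
    simp [hS]
  have hq : Fintype.card F ≤ Nat.card (B ⧸ S) := by
    obtain ⟨b, hb⟩ : ∃ b, b ∉ S := by
      by_contra h
      push Not at h
      exact hne (Submodule.eq_top_iff'.2 h)
    rw [← Nat.card_eq_fintype_card]
    refine Nat.card_le_card_of_injective (fun r : F => r • (S.mkQ b)) fun r r' h => ?_
    have hb' : S.mkQ b ≠ 0 := by simpa using hb
    exact smul_left_injective F hb' h
  rw [hS', ← Nat.card_eq_fintype_card (α := B), hcard, mul_comm]
  push_cast
  exact mul_le_mul_of_nonneg_left (by exact_mod_cast hq) (by positivity)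

variable [Fintype A]

/-- Character sums over the graph points `(δ, κ a δ)`. -/
theorem norm_sum_addChar_le (hbal : ∀ (r : F) a b, κ (r • a) b = κ a (r • b))
    (hspan : AddSubgroup.closure {c | ∃ a b, κ a b = c} = ⊤) {ψ : AddChar (B × C) ℂ}
    (hψ : ψ ≠ 0) :
    ‖∑ x : A × B, ψ (x.2, κ x.1 x.2)‖ ≤
      (Fintype.card A : ℝ) * Fintype.card B / Fintype.card F := by
  classical
  set β : AddChar B ℂ := ψ.compAddMonoidHom (AddMonoidHom.inl B C) with hβ
  set γ : AddChar C ℂ := ψ.compAddMonoidHom (AddMonoidHom.inr B C) with hγ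
  have hsplit : ∀ b c, ψ (b, c) = β b * γ c := by
    intro b c
    simp [hβ, hγ, ← AddChar.map_add_eq_mul]
  have hsum : ∑ x : A × B, ψ (x.2, κ x.1 x.2) =
      ∑ b, β b * if ∀ a, γ (κ a b) = 1 then (Fintype.card A : ℂ) else 0 := by
    rw [Fintype.sum_prod_type_right]
    refine sum_congr rfl fun b _ => ?_
    simp only [hsplit, ← mul_sum]
    congr 1
    have h := AddChar.sum_eq_ite (γ.compAddMonoidHom (κ.flip b))
    simp only [AddChar.compAddMonoidHom_apply, AddMonoidHom.flip_apply] at h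
    rw [h]
    have hiff : γ.compAddMonoidHom (κ.flip b) = 0 ↔ ∀ a, γ (κ a b) = 1 :=
      ⟨fun h a => by simpa using congrArg (fun χ : AddChar A ℂ => χ a) h,
        fun h => DFunLike.ext _ _ fun a => by simpa using h a⟩
    simp only [hiff]
  rw [hsum]
  by_cases hγ0 : γ = 0
  · have hβ0 : β ≠ 0 := by
      intro h
      refine hψ (DFunLike.ext _ _ fun x => ?_)
      obtain ⟨b, c⟩ := x
      rw [hsplit, h, hγ0]
      simp
    have : ∑ b, β b = 0 := AddChar.sum_eq_zero_iff_ne_zero.2 hβ0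
    simp only [hγ0, AddChar.zero_apply, implies_true, if_true]
    rw [← sum_mul, this, zero_mul, norm_zero]
    positivity
  · have hq : (0 : ℝ) < Fintype.card F := by exact_mod_cast Fintype.card_pos
    have h1 := card_degenerate_le κ hbal hspan hγ0
    calc _ ≤ ∑ b, ‖β b * if ∀ a, γ (κ a b) = 1 then (Fintype.card A : ℂ) else 0‖ :=
          norm_sum_le _ _
      _ = ∑ b, if ∀ a, γ (κ a b) = 1 then (Fintype.card A : ℝ) else 0 := by
          refine sum_congr rfl fun b _ => ?_
          rw [norm_mul, AddChar.norm_apply, one_mul]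
          split_ifs <;> simp
      _ = Fintype.card A * ((univ.filter fun b => ∀ a, γ (κ a b) = 1).card : ℝ) := by
          rw [← sum_filter, sum_const, nsmul_eq_mul, mul_comm]
      _ ≤ _ := by
          rw [le_div_iff₀ hq]
          have := mul_le_mul_of_nonneg_left h1 (by positivity : (0 : ℝ) ≤ Fintype.card A)
          linarith

variable [Fintype C]

/-- The spectral gap of the bipartite graph on `B × C` and `A × C` in which `(b, c)` is adjacent to
`(a, c - κ a b)`. Squaring the adjacency operator gives a convolution operator on `B × C`. -/
theorem heisenberg_bilinear_le (hbal : ∀ (r : F) a b, κ (r • a) b = κ a (r • b))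
    (hspan : AddSubgroup.closure {c | ∃ a b, κ a b = c} = ⊤) {P : B → C → ℝ}
    (hP : ∑ b, ∑ c, P b c = 0) (Q : A → C → ℝ) :
    2 * ∑ a, ∑ b, ∑ c, P b c * Q a (c - κ a b) ≤
      1 / √(Fintype.card F) * (Fintype.card A * ∑ b, ∑ c, P b c ^ 2 +
        Fintype.card B * ∑ a, ∑ c, Q a c ^ 2) := by
  classical
  have hq : (0 : ℝ) < Fintype.card F := by exact_mod_cast Fintype.card_pos
  have hB : (0 : ℝ) < Fintype.card B := by exact_mod_cast Fintype.card_pos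
  set R : ℝ := √(Fintype.card F) with hR
  have hR0 : 0 < R := Real.sqrt_pos.2 hq
  have hRR : R ^ 2 = Fintype.card F := Real.sq_sqrt hq.le
  set Φ : A → C → ℝ := fun a e => ∑ b, P b (e + κ a b) with hΦ
  have h1 : ∑ a, ∑ b, ∑ c, P b c * Q a (c - κ a b) = ∑ a, ∑ e, Φ a e * Q a e := by
    refine sum_congr rfl fun a _ => ?_
    simp only [hΦ, sum_mul]
    rw [sum_comm (s := univ (α := C))]
    refine sum_congr rfl fun b _ => ?_
    rw [← Equiv.sum_comp (Equiv.addRight (κ a b))]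
    simp
  have h2 : ∑ a, ∑ e, Φ a e ^ 2 ≤
      (Fintype.card A : ℝ) * Fintype.card B / Fintype.card F * ∑ b, ∑ c, P b c ^ 2 := by
    have h3 := sum_autocorrelation_le (fun x : A × B => ((x.2, κ x.1 x.2) : B × C))
      (fun ψ hψ => norm_sum_addChar_le κ hbal hspan hψ) (f := fun x => P x.1 x.2)
      (by rw [Fintype.sum_prod_type]; exact hP)
    simp only [Fintype.sum_prod_type, Prod.mk_add_mk] at h3
    refine le_trans (le_of_eq ?_) h3
    refine sum_congr rfl fun a _ => ?_
    have h4 : ∀ e, Φ a e ^ 2 = ∑ b, ∑ δ, P (b + δ) (e + κ a (b + δ)) * P b (e + κ a b) := by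
      intro e
      rw [sq, hΦ, sum_mul_sum, sum_comm]
      refine sum_congr rfl fun b _ => ?_
      rw [← Equiv.sum_comp (Equiv.addLeft b)]
      rfl
    have h5 : ∀ δ b, ∑ c, P (b + δ) (c + κ a δ) * P b c =
        ∑ e, P (b + δ) (e + κ a (b + δ)) * P b (e + κ a b) := by
      intro δ b
      rw [← Equiv.sum_comp (Equiv.addRight (κ a b))]
      simp only [Equiv.coe_addRight, map_add, add_assoc]
    simp only [h4, h5]
    rw [sum_comm]
    conv_rhs => rw [sum_comm]
    exact sum_congr rfl fun b _ => sum_comm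
  have h5 : 2 * ∑ a, ∑ e, Φ a e * Q a e ≤
      R / Fintype.card B * ∑ a, ∑ e, Φ a e ^ 2 +
        Fintype.card B / R * ∑ a, ∑ e, Q a e ^ 2 := by
    simp only [mul_sum, ← sum_add_distrib]
    refine sum_le_sum fun a _ => sum_le_sum fun e _ => ?_
    have h6 : R / Fintype.card B * Φ a e ^ 2 + Fintype.card B / R * Q a e ^ 2 -
        2 * (Φ a e * Q a e) = R / Fintype.card B * (Φ a e - Fintype.card B / R * Q a e) ^ 2 := by
      field_simp
      ring
    have h7 : 0 ≤ R / Fintype.card B * (Φ a e - Fintype.card B / R * Q a e) ^ 2 := by positivity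
    linarith
  rw [h1]
  refine h5.trans ?_
  have h8 := mul_le_mul_of_nonneg_left h2 (by positivity : 0 ≤ R / Fintype.card B)
  refine (add_le_add_left h8 _).trans (le_of_eq ?_)
  rw [← hRR]
  field_simp

end Heisenberg

/-! ### Heisenberg groups -/

section HeisenbergGroup

variable {F A B C Γ : Type*} [AddCommGroup A] [AddCommGroup B] [AddCommGroup C] [Group Γ]

/-- In a group generated by two abelian subgroups `x A` and `y B` whose commutators are central
and given by `κ`, every element is of the form `y b * z c * x a`. -/
theorem mem_closure_iff_heisenberg (κ : A →+ B →+ C)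
    (hspan : AddSubgroup.closure {c | ∃ a b, κ a b = c} = ⊤) {x : A → Γ} {y : B → Γ} {z : C → Γ}
    (hx : ∀ a a', x (a + a') = x a * x a') (hy : ∀ b b', y (b + b') = y b * y b')
    (hz : ∀ c c', z (c + c') = z c * z c') (hxy : ∀ a b, x a * y b = y b * x a * z (κ a b))
    (hxz : ∀ a c, x a * z c = z c * x a) (hyz : ∀ b c, y b * z c = z c * y b) (h : Γ) :
    h ∈ Subgroup.closure (Set.range x ∪ Set.range y) ↔ ∃ b c a, y b * z c * x a = h := by
  have hx0 : x 0 = 1 := by simpa using hx 0 0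
  have hy0 : y 0 = 1 := by simpa using hy 0 0
  have hz0 : z 0 = 1 := by simpa using hz 0 0
  have hxn : ∀ a, (x a)⁻¹ = x (-a) := fun a => inv_eq_of_mul_eq_one_right (by rw [← hx]; simp [hx0])
  have hyn : ∀ b, (y b)⁻¹ = y (-b) := fun b => inv_eq_of_mul_eq_one_right (by rw [← hy]; simp [hy0])
  have hzn : ∀ c, (z c)⁻¹ = z (-c) := fun c => inv_eq_of_mul_eq_one_right (by rw [← hz]; simp [hz0])
  have hmx : ∀ b c a a', y b * z c * x a * x a' = y b * z c * x (a + a') := fun b c a a' => by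
    rw [hx, mul_assoc]
  have hmy : ∀ b c a b', y b * z c * x a * y b' = y (b + b') * z (c + κ a b') * x a := by
    intro b c a b'
    rw [mul_assoc _ (x a), hxy, mul_assoc (y b') (x a), hxz, ← mul_assoc, ← mul_assoc,
      mul_assoc (y b), ← hyz, hy, hz]
    group
  constructor
  · intro hh
    induction hh using Subgroup.closure_induction_right with
    | one => exact ⟨0, 0, 0, by simp [hx0, hy0, hz0]⟩
    | mul_right h _ g hg ih =>
      obtain ⟨b, c, a, rfl⟩ := ih
      rcases hg with ⟨a', rfl⟩ | ⟨b', rfl⟩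
      · exact ⟨_, _, _, (hmx b c a a').symm⟩
      · exact ⟨_, _, _, (hmy b c a b').symm⟩
    | mul_inv_cancel h _ g hg ih =>
      obtain ⟨b, c, a, rfl⟩ := ih
      rcases hg with ⟨a', rfl⟩ | ⟨b', rfl⟩
      · exact ⟨_, _, _, by rw [hxn, hmx]⟩
      · exact ⟨_, _, _, by rw [hyn, hmy]⟩
  · rintro ⟨b, c, a, rfl⟩
    have hxm : ∀ a, x a ∈ Subgroup.closure (Set.range x ∪ Set.range y) := fun a =>
      Subgroup.subset_closure (Or.inl ⟨a, rfl⟩)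
    have hym : ∀ b, y b ∈ Subgroup.closure (Set.range x ∪ Set.range y) := fun b =>
      Subgroup.subset_closure (Or.inr ⟨b, rfl⟩)
    have hzm : z c ∈ Subgroup.closure (Set.range x ∪ Set.range y) := by
      have hc : c ∈ AddSubgroup.closure {c | ∃ a b, κ a b = c} := hspan ▸ AddSubgroup.mem_top c
      induction hc using AddSubgroup.closure_induction with
      | mem c hc =>
        obtain ⟨a, b, rfl⟩ := hc
        have : z (κ a b) = (y b * x a)⁻¹ * (x a * y b) := by rw [hxy]; group
        rw [this]
        exact mul_mem (inv_mem (mul_mem (hym b) (hxm a))) (mul_mem (hxm a) (hym b))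
      | zero => rw [hz0]; exact one_mem _
      | add c c' _ _ hc hc' => rw [hz]; exact mul_mem hc hc'
      | neg c _ hc => rw [← hzn]; exact inv_mem hc
    exact mul_mem (mul_mem (hym b) hzm) (hxm a)

variable [Field F] [Fintype F] [Module F A] [Fintype A] [Module F B] [Fintype B] [Fintype C]

/-- The spectral gap of the coset graph of `x A` and `y B` in a Heisenberg group. Together, `φ` and
`ψ` are a function on the vertices, and `2 * ∑ h, φ h * ψ h` is the quadratic form of the walk. In
the coordinates `y b * z c` and `x a * z c` for the two kinds of cosets this is
`heisenberg_bilinear_le`. -/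
theorem heisenberg_group_bound (κ : A →+ B →+ C) (hbal : ∀ (r : F) a b, κ (r • a) b = κ a (r • b))
    (hspan : AddSubgroup.closure {c | ∃ a b, κ a b = c} = ⊤) {x : A → Γ} {y : B → Γ} {z : C → Γ}
    (hx : ∀ a a', x (a + a') = x a * x a') (hy : ∀ b b', y (b + b') = y b * y b')
    (hz : ∀ c c', z (c + c') = z c * z c') (hxy : ∀ a b, x a * y b = y b * x a * z (κ a b))
    (hxz : ∀ a c, x a * z c = z c * x a) (hyz : ∀ b c, y b * z c = z c * y b)
    (hinj : ∀ b c a b' c' a', y b * z c * x a = y b' * z c' * x a' → b = b' ∧ c = c' ∧ a = a')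
    {H : Subgroup Γ} [Fintype H] (hH : H = Subgroup.closure (Set.range x ∪ Set.range y))
    {φ ψ : Γ → ℝ} (hφ : ∀ h a, φ (h * x a) = φ h) (hψ : ∀ h b, ψ (h * y b) = ψ h)
    (hmean : ∑ h : H, (φ h + ψ h) = 0) :
    2 * ∑ h : H, φ h * ψ h ≤ 1 / √(Fintype.card F) * ∑ h : H, (φ h ^ 2 + ψ h ^ 2) := by
  have hmem : ∀ h, h ∈ H ↔ ∃ b c a, y b * z c * x a = h := by
    rw [hH]
    exact mem_closure_iff_heisenberg κ hspan hx hy hz hxy hxz hyz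
  let e : B × C × A → H := fun t => ⟨y t.1 * z t.2.1 * x t.2.2, (hmem _).2 ⟨_, _, _, rfl⟩⟩
  have he : Function.Bijective e := by
    constructor
    · rintro ⟨b, c, a⟩ ⟨b', c', a'⟩ h
      obtain ⟨rfl, rfl, rfl⟩ := hinj _ _ _ _ _ _ (congrArg Subtype.val h)
      rfl
    · rintro ⟨h, hh⟩
      obtain ⟨b, c, a, rfl⟩ := (hmem h).1 hh
      exact ⟨(b, c, a), rfl⟩
  have hsum : ∀ G : Γ → ℝ, ∑ h : H, G h = ∑ b, ∑ c, ∑ a, G (y b * z c * x a) := by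
    intro G
    rw [← Function.Bijective.sum_comp he (fun h : H => G h)]
    simp only [Fintype.sum_prod_type, e]
  set P : B → C → ℝ := fun b c => φ (y b * z c) with hP
  set Q : A → C → ℝ := fun a c => ψ (x a * z c) with hQ
  have hφP : ∀ b c a, φ (y b * z c * x a) = P b c := fun b c a => hφ _ _
  have hψQ : ∀ b c a, ψ (y b * z c * x a) = Q a (c - κ a b) := by
    intro b c a
    have : y b * z c * x a = x a * z (c - κ a b) * y b := by
      rw [mul_assoc (x a), ← hyz, ← mul_assoc, hxy, mul_assoc (y b * x a), ← hz, add_sub_cancel,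
        mul_assoc, ← hxz,
        ← mul_assoc]
    rw [this, hψ]
  have hA : (0 : ℝ) < Fintype.card A := by exact_mod_cast Fintype.card_pos
  have hB : (0 : ℝ) < Fintype.card B := by exact_mod_cast Fintype.card_pos
  have hC : (0 : ℝ) < Fintype.card C := by exact_mod_cast Fintype.card_pos
  have hQsum : ∀ w : ℝ → ℝ, ∑ b, ∑ c, ∑ a, w (Q a (c - κ a b)) =
      Fintype.card B * ∑ a, ∑ c, w (Q a c) := by
    intro w
    have : ∀ b, ∑ c, ∑ a, w (Q a (c - κ a b)) = ∑ a, ∑ c, w (Q a c) := by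
      intro b
      rw [sum_comm]
      refine sum_congr rfl fun a _ => ?_
      exact Equiv.sum_comp (Equiv.subRight (κ a b)) fun c => w (Q a c)
    simp only [this, sum_const, card_univ, nsmul_eq_mul]
  -- subtract the mean `m` from `P`; the mean of `Q` is `-m`
  set m : ℝ := (∑ b, ∑ c, P b c) / (Fintype.card B * Fintype.card C) with hm
  have hPm : ∑ b, ∑ c, P b c = m * (Fintype.card B * Fintype.card C) := by
    rw [hm]; field_simp
  have hQm : ∑ a, ∑ c, Q a c = -m * (Fintype.card A * Fintype.card C) := by
    rw [sum_add_distrib, hsum φ, hsum ψ] at hmean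
    simp only [hφP, hψQ, sum_const, card_univ, nsmul_eq_mul, ← mul_sum] at hmean
    have h1 := hQsum fun t => t
    rw [h1, hPm] at hmean
    refine mul_left_cancel₀ hB.ne' ?_
    linarith
  have key := heisenberg_bilinear_le κ hbal hspan (P := fun b c => P b c - m)
    (by
      simp only [sum_sub_distrib, sum_const, card_univ, nsmul_eq_mul]
      rw [hPm]; ring) Q
  have hcross : ∑ a, ∑ b, ∑ c, (P b c - m) * Q a (c - κ a b) =
      ∑ h : H, φ h * ψ h + m ^ 2 * (Fintype.card A * Fintype.card B * Fintype.card C) := by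
    rw [hsum fun h => φ h * ψ h]
    simp only [hφP, hψQ, sub_mul, sum_sub_distrib]
    have h1 : ∑ a, ∑ b, ∑ c, m * Q a (c - κ a b) = m * (Fintype.card B * ∑ a, ∑ c, Q a c) := by
      rw [← hQsum fun t => t]
      simp only [mul_sum]
      rw [sum_comm]
      exact sum_congr rfl fun b _ => sum_comm
    have h2 : ∑ a, ∑ b, ∑ c, P b c * Q a (c - κ a b) =
        ∑ b, ∑ c, ∑ a, P b c * Q a (c - κ a b) := by
      rw [sum_comm]
      exact sum_congr rfl fun b _ => sum_comm
    rw [h1, h2, hQm]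
    ring
  have hPsq : ∑ b, ∑ c, (P b c - m) ^ 2 =
      ∑ b, ∑ c, P b c ^ 2 - m ^ 2 * (Fintype.card B * Fintype.card C) := by
    simp only [sub_sq, sum_add_distrib, sum_sub_distrib, sum_const, card_univ, nsmul_eq_mul,
      ← sum_mul, ← mul_sum]
    rw [hPm]
    ring
  have hnorm : ∑ h : H, (φ h ^ 2 + ψ h ^ 2) = Fintype.card A * ∑ b, ∑ c, P b c ^ 2 +
      Fintype.card B * ∑ a, ∑ c, Q a c ^ 2 := by
    rw [sum_add_distrib, hsum fun h => φ h ^ 2, hsum fun h => ψ h ^ 2]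
    simp only [hφP, hψQ, sum_const, card_univ, nsmul_eq_mul, ← mul_sum]
    rw [hQsum fun t => t ^ 2]
  rw [hcross, hPsq] at key
  rw [hnorm]
  have h1 : 0 ≤ m ^ 2 * (Fintype.card A * Fintype.card B * Fintype.card C) := by positivity
  have h2 : 0 ≤ 1 / √(Fintype.card F : ℝ) *
      (Fintype.card A * (m ^ 2 * (Fintype.card B * Fintype.card C))) := by positivity
  linarith

end HeisenbergGroup

/-! ### Expansion in all links from expansion in the smallest ones -/

section AllLinks

variable {Γ U : Type*} [Fintype Γ] [DecidableEq U] {top : Γ → Finset U} {d : ℕ}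

theorem IsLocalExpander.mono {s : Finset U} {lam lam' : ℝ} (h : IsLocalExpander top d s lam)
    (hs : s.card < d) (hle : lam ≤ lam') : IsLocalExpander top d s lam' := by
  intro f hf
  refine (h f hf).trans (mul_le_mul_of_nonneg_right ?_
    (sum_nonneg fun _ _ => sum_nonneg fun _ _ => sq_nonneg _))
  have : ((s.card + 1 : ℕ) : ℝ) ≤ d := by exact_mod_cast hs
  push_cast at this
  have := mul_le_mul_of_nonneg_right hle (by linarith : (0 : ℝ) ≤ (d : ℝ) - s.card - 1)
  linarith

/-- All eigenvalues of a random walk are at most `1`. -/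
theorem isLocalExpander_one (htop : ∀ g, (top g).card = d) (s : Finset U) :
    IsLocalExpander top d s 1 := by
  intro f _
  rw [mul_sum]
  refine sum_le_sum fun g hg => ?_
  have h := sq_sum_le_card_mul_sum_sq (s := top g \ s) (f := f)
  rw [card_link_top htop hg] at h
  refine h.trans_eq ?_
  rw [linkSum]
  ring

/-- Iterating the trickling-down theorem from the links of codimension two. -/
theorem isLocalExpander_of_base [Fintype U] {r : ℝ} (htop : ∀ g, (top g).card = d)
    (hconn : ∀ s : Finset U, s.card + 2 ≤ d → IsLinkConnected top s)
    (hbase : ∀ s : Finset U, s.card + 2 = d → IsLocalExpander top d s (1 / r))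
    (hr : (d : ℝ) - 2 < r) (m : ℕ) :
    ∀ s : Finset U, s.card + 2 + m = d → IsLocalExpander top d s (1 / (r - m)) := by
  induction m with
  | zero => simpa using hbase
  | succ m ih =>
    intro s hs
    have h1 : (m : ℝ) + 1 < r := by
      refine lt_of_le_of_lt ?_ hr
      rw [← hs]
      push_cast
      have : (0 : ℝ) ≤ s.card := by positivity
      linarith
    have h2 : 0 < r - m := by linarith
    have hlt : 1 / (r - m) < 1 := by
      rw [div_lt_one h2]
      linarith
    have h := IsLocalExpander.trickle_down htop (by omega) hlt (hconn s (by omega))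
      fun v hv _ => ih (insert v s) (by rw [card_insert_of_notMem hv]; omega)
    have h3 : 1 / (r - m) / (1 - 1 / (r - m)) = 1 / (r - (m + 1 : ℕ)) := by
      have h4 : r - m - 1 ≠ 0 := by linarith
      have h5 : r - (m + 1 : ℕ) = r - m - 1 := by push_cast; ring
      rw [h5]
      field_simp
    rwa [h3] at h

end AllLinks

/-! ### Links in coset complexes -/

section CosetLinks

variable {ι Γ : Type*} [Group Γ]

/-- The intersection of the subgroups `K i` with `i ∈ T`: the stabiliser of a face of type `T`. -/
def cosetStabilizer (K : ι → Subgroup Γ) (T : Finset ι) : Subgroup Γ := ⨅ i ∈ T, K i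

theorem mem_cosetStabilizer {K : ι → Subgroup Γ} {T : Finset ι} {g : Γ} :
    g ∈ cosetStabilizer K T ↔ ∀ i ∈ T, g ∈ K i := by
  simp [cosetStabilizer, Subgroup.mem_iInf]

/-- The vertex `g K_i`. -/
def cosetVertex (K : ι → Subgroup Γ) (i : ι) (g : Γ) : CosetVertex K :=
  ⟨i, (QuotientGroup.mk g : Γ ⧸ K i)⟩

open Classical in
/-- The set of types of the vertices of `s`. -/
noncomputable def typeSet {K : ι → Subgroup Γ} (s : Finset (CosetVertex K)) : Finset ι :=
  s.image fun v => v.1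

variable {K : ι → Subgroup Γ}

theorem mem_typeSet {s : Finset (CosetVertex K)} {i : ι} :
    i ∈ typeSet s ↔ ∃ v ∈ s, v.1 = i := by
  classical
  rw [typeSet, mem_image]

theorem cosetVertex_eq_iff {i : ι} {g h : Γ} :
    cosetVertex K i g = cosetVertex K i h ↔ g⁻¹ * h ∈ K i := by
  rw [← QuotientGroup.eq]
  constructor
  · intro h1
    exact eq_of_heq (Sigma.mk.inj h1).2
  · intro h1
    unfold cosetVertex
    rw [h1]

theorem cosetVertex_mul {i : ι} {g k : Γ} (hk : k ∈ K i) :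
    cosetVertex K i (g * k) = cosetVertex K i g :=
  (cosetVertex_eq_iff.2 (by simpa using hk)).symm

variable [Fintype ι]

open Classical in
theorem cosetTopFace_eq (g : Γ) :
    cosetTopFace K g = univ.image fun i => cosetVertex K i g := rfl

theorem mem_cosetTopFace {g : Γ} {v : CosetVertex K} :
    v ∈ cosetTopFace K g ↔ v = cosetVertex K v.1 g := by
  classical
  simp only [cosetTopFace_eq, mem_image, mem_univ, true_and]
  constructor
  · rintro ⟨i, rfl⟩
    rfl
  · intro h
    exact ⟨v.1, h.symm⟩

theorem cosetVertex_mem (i : ι) (g : Γ) : cosetVertex K i g ∈ cosetTopFace K g :=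
  mem_cosetTopFace.2 rfl

theorem card_cosetTopFace (g : Γ) : (cosetTopFace K g).card = Fintype.card ι := by
  classical
  rw [cosetTopFace_eq, card_image_of_injective, card_univ]
  intro i j h
  exact congrArg (fun v : CosetVertex K => v.1) h

theorem cosetTopFace_injective (h : cosetStabilizer K univ = ⊥) :
    Function.Injective (cosetTopFace K) := by
  intro g g' hg
  have h1 : g⁻¹ * g' ∈ cosetStabilizer K univ := by
    rw [mem_cosetStabilizer]
    intro i _
    have h2 := cosetVertex_mem (K := K) i g
    rw [hg, mem_cosetTopFace] at h2
    exact cosetVertex_eq_iff.1 h2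
  rw [h, Subgroup.mem_bot] at h1
  exact inv_mul_eq_one.1 h1

theorem card_typeSet {s : Finset (CosetVertex K)} {g : Γ} (hg : s ⊆ cosetTopFace K g) :
    (typeSet s).card = s.card := by
  classical
  refine card_image_of_injOn fun v hv w hw hvw => ?_
  have h1 := mem_cosetTopFace.1 (hg hv)
  have h2 := mem_cosetTopFace.1 (hg hw)
  have hvw' : v.1 = w.1 := hvw
  rw [h1, h2, hvw']

theorem subset_cosetTopFace_iff {s : Finset (CosetVertex K)} {g h : Γ}
    (hg : s ⊆ cosetTopFace K g) :
    s ⊆ cosetTopFace K h ↔ g⁻¹ * h ∈ cosetStabilizer K (typeSet s) := by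
  classical
  simp only [mem_cosetStabilizer, typeSet, mem_image, forall_exists_index, and_imp,
    forall_apply_eq_imp_iff₂]
  refine forall₂_congr fun v hv => ?_
  rw [← cosetVertex_eq_iff, mem_cosetTopFace, ← mem_cosetTopFace.1 (hg hv)]

open Classical in
/-- The vertices of a top face in the link of `s` are those whose type is not a type of `s`. -/
theorem linkSum_cosetTopFace [DecidableEq ι] {s : Finset (CosetVertex K)} {g : Γ}
    (hg : s ⊆ cosetTopFace K g) (f : CosetVertex K → ℝ) :
    linkSum (cosetTopFace K) s f g = ∑ i with i ∉ typeSet s, f (cosetVertex K i g) := by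
  have h : cosetTopFace K g \ s =
      (univ.filter fun i => i ∉ typeSet s).image fun i => cosetVertex K i g := by
    ext v
    simp only [mem_sdiff, mem_image, mem_filter, mem_univ, true_and, typeSet, not_exists, not_and]
    constructor
    · rintro ⟨h1, h2⟩
      refine ⟨v.1, fun w hw hwv => h2 ?_, (mem_cosetTopFace.1 h1).symm⟩
      rwa [mem_cosetTopFace.1 h1, ← hwv, ← mem_cosetTopFace.1 (hg hw)]
    · rintro ⟨i, hi, rfl⟩
      exact ⟨cosetVertex_mem i g, fun hv => hi _ hv rfl⟩
  rw [linkSum, h, sum_image]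
  intro i _ j _ hij
  exact congrArg (fun v : CosetVertex K => v.1) hij

variable [Fintype Γ]

open Classical in
theorem sum_topsOver_coset {s : Finset (CosetVertex K)} {g : Γ} (hg : s ⊆ cosetTopFace K g)
    (G : Γ → ℝ) : ∑ h ∈ topsOver (cosetTopFace K) s, G h =
      ∑ k : cosetStabilizer K (typeSet s), G (g * k) := by
  symm
  refine sum_bij (fun k _ => g * k.1) (fun k _ => ?_) (fun k _ k' _ h => ?_) (fun h hh => ?_)
    fun _ _ => rfl
  · rw [mem_topsOver, subset_cosetTopFace_iff hg]
    simp
  · exact Subtype.ext (mul_left_cancel h)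
  · rw [mem_topsOver, subset_cosetTopFace_iff hg] at hh
    exact ⟨⟨_, hh⟩, mem_univ _, by simp⟩

open Classical in
/-- The link of a face of type `T` is connected as soon as its stabiliser is generated by the
stabilisers of the vertices of its link. -/
theorem isLinkConnected_coset [DecidableEq ι]
    (hgen : ∀ T : Finset ι, T.card + 2 ≤ Fintype.card ι →
      cosetStabilizer K T ≤ Subgroup.closure {k | ∃ i ∉ T, k ∈ cosetStabilizer K (insert i T)})
    (s : Finset (CosetVertex K)) (hs : s.card + 2 ≤ Fintype.card ι) :
    IsLinkConnected (cosetTopFace K) s := by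
  intro f hf
  rcases (topsOver (cosetTopFace K) s).eq_empty_or_nonempty with h0 | ⟨g, hg⟩
  · exact ⟨0, fun g hg => by simp [h0] at hg⟩
  rw [mem_topsOver] at hg
  set T := typeSet s with hT
  have hTc : T.card = s.card := card_typeSet hg
  have hout : ∀ h, s ⊆ cosetTopFace K h → ∀ i ∉ T,
      cosetVertex K i h ∈ cosetTopFace K h \ s := by
    intro h _ i hi
    refine mem_sdiff.2 ⟨cosetVertex_mem i h, fun hv => hi ?_⟩
    exact mem_typeSet.2 ⟨_, hv, rfl⟩
  have hsame : ∀ h, s ⊆ cosetTopFace K h → ∀ i ∉ T, ∀ j ∉ T,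
      f (cosetVertex K i h) = f (cosetVertex K j h) := fun h hh i hi j hj =>
    hf h (mem_topsOver.2 hh) _ (hout h hh i hi) _ (hout h hh j hj)
  obtain ⟨i₀, hi₀⟩ : ∃ i, i ∉ T := by
    by_contra! h
    have := card_le_card fun i (_ : i ∈ (univ : Finset ι)) => h i
    rw [card_univ] at this
    omega
  have hle : ∀ {i k}, k ∈ cosetStabilizer K (insert i T) → k ∈ cosetStabilizer K T ∧ k ∈ K i :=
    fun hk => ⟨mem_cosetStabilizer.2 fun j hj => mem_cosetStabilizer.1 hk j (mem_insert_of_mem hj),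
      mem_cosetStabilizer.1 hk _ (mem_insert_self _ _)⟩
  have hstep : ∀ h i k, i ∉ T → k ∈ cosetStabilizer K (insert i T) →
      h ∈ cosetStabilizer K T ∧ f (cosetVertex K i₀ (g * h)) = f (cosetVertex K i₀ g) →
      h * k ∈ cosetStabilizer K T ∧
        f (cosetVertex K i₀ (g * (h * k))) = f (cosetVertex K i₀ g) := by
    rintro h i k hi hk ⟨hh, he⟩
    have hk' := hle hk
    have hhk := mul_mem hh hk'.1
    refine ⟨hhk, ?_⟩
    have h1 : s ⊆ cosetTopFace K (g * h) := (subset_cosetTopFace_iff hg).2 (by simpa using hh)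
    have h2 : s ⊆ cosetTopFace K (g * (h * k)) :=
      (subset_cosetTopFace_iff hg).2 (by simpa using hhk)
    rw [hsame _ h2 i₀ hi₀ i hi, ← mul_assoc, cosetVertex_mul hk'.2, ← hsame _ h1 i₀ hi₀ i hi, he]
  have hall : ∀ h ∈ cosetStabilizer K T,
      f (cosetVertex K i₀ (g * h)) = f (cosetVertex K i₀ g) := by
    intro h hh
    suffices h ∈ cosetStabilizer K T ∧
        f (cosetVertex K i₀ (g * h)) = f (cosetVertex K i₀ g) from this.2
    have hc := hgen T (by omega) hh
    clear hh
    induction hc using Subgroup.closure_induction_right with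
    | one => exact ⟨one_mem _, by rw [mul_one]⟩
    | mul_right h _ k hk ih =>
      obtain ⟨i, hi, hk⟩ := hk
      exact hstep h i k hi hk ih
    | mul_inv_cancel h _ k hk ih =>
      obtain ⟨i, hi, hk⟩ := hk
      exact hstep h i _ hi (inv_mem hk) ih
  refine ⟨f (cosetVertex K i₀ g), fun h hh v hv => ?_⟩
  rw [mem_topsOver] at hh
  have hv' := mem_sdiff.1 hv
  have h1 : v.1 ∉ T := by
    intro h
    obtain ⟨w, hw, hwv⟩ := mem_typeSet.1 h
    refine hv'.2 ?_
    rwa [mem_cosetTopFace.1 hv'.1, ← hwv, ← mem_cosetTopFace.1 (hh hw)]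
  rw [mem_cosetTopFace.1 hv'.1, hsame h hh _ h1 i₀ hi₀]
  have := hall _ ((subset_cosetTopFace_iff hg).1 hh)
  rwa [mul_inv_cancel_left] at this

open Classical in
/-- The link of a face of codimension two is the bipartite coset graph of two subgroups. -/
theorem isLocalExpander_coset_base [DecidableEq ι] {lam : ℝ}
    (hbase : ∀ T : Finset ι, T.card + 2 = Fintype.card ι → ∀ i ∉ T, ∀ j ∉ T, i ≠ j →
      ∀ φ ψ : Γ → ℝ, (∀ h, ∀ k ∈ K i, φ (h * k) = φ h) → (∀ h, ∀ k ∈ K j, ψ (h * k) = ψ h) →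
      ∑ h : cosetStabilizer K T, (φ h + ψ h) = 0 →
      2 * ∑ h : cosetStabilizer K T, φ h * ψ h ≤
        lam * ∑ h : cosetStabilizer K T, (φ h ^ 2 + ψ h ^ 2))
    (s : Finset (CosetVertex K)) (hs : s.card + 2 = Fintype.card ι) :
    IsLocalExpander (cosetTopFace K) (Fintype.card ι) s lam := by
  intro f hf
  rcases (topsOver (cosetTopFace K) s).eq_empty_or_nonempty with h0 | ⟨g, hg⟩
  · simp [h0]
  rw [mem_topsOver] at hg
  set T := typeSet s with hT
  have hTc : T.card = s.card := card_typeSet hg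
  have hcompl : (univ.filter fun i => i ∉ T).card = 2 := by
    have h1 := card_compl T
    have h2 : (univ.filter fun i => i ∉ T) = Tᶜ := by
      ext i
      simp
    rw [h2]
    omega
  obtain ⟨i, j, hij, hpair⟩ := card_eq_two.1 hcompl
  have hi : i ∉ T := by
    have : i ∈ univ.filter fun i => i ∉ T := by rw [hpair]; simp
    exact (mem_filter.1 this).2
  have hj : j ∉ T := by
    have : j ∈ univ.filter fun i => i ∉ T := by rw [hpair]; simp
    exact (mem_filter.1 this).2
  have hsum : ∀ F : CosetVertex K → ℝ, ∀ k : cosetStabilizer K T,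
      linkSum (cosetTopFace K) s F (g * k) =
        F (cosetVertex K i (g * k)) + F (cosetVertex K j (g * k)) := by
    intro F k
    have h1 : s ⊆ cosetTopFace K (g * k) :=
      (subset_cosetTopFace_iff hg).2 (by rw [inv_mul_cancel_left]; exact k.2)
    rw [linkSum_cosetTopFace h1, ← hT, hpair, sum_pair hij]
  rw [sum_topsOver_coset hg] at hf ⊢
  rw [sum_topsOver_coset hg]
  rw [sum_congr rfl fun k _ => hsum f k] at hf
  rw [sum_congr rfl fun k _ => by rw [hsum f k], sum_congr rfl fun k _ => hsum (fun u => f u ^ 2) k]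
  have key := hbase T (by omega) i hi j hj hij (fun h => f (cosetVertex K i (g * h)))
    (fun h => f (cosetVertex K j (g * h)))
    (fun h k hk => by rw [← mul_assoc, cosetVertex_mul hk])
    (fun h k hk => by rw [← mul_assoc, cosetVertex_mul hk]) hf
  have hd : (Fintype.card ι : ℝ) - s.card - 1 = 1 := by
    rw [← hs]
    push_cast
    ring
  rw [hd]
  have hsq : ∑ k : cosetStabilizer K T,
      (f (cosetVertex K i (g * k)) + f (cosetVertex K j (g * k))) ^ 2 =
      ∑ k : cosetStabilizer K T,
        (f (cosetVertex K i (g * k)) ^ 2 + f (cosetVertex K j (g * k)) ^ 2) +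
      2 * ∑ k : cosetStabilizer K T,
        f (cosetVertex K i (g * k)) * f (cosetVertex K j (g * k)) := by
    rw [mul_sum, ← sum_add_distrib]
    exact sum_congr rfl fun k _ => by ring
  rw [hsq]
  linarith

open Classical in
/-- If the intersections of two of the subgroups have bipartite coset graphs with second largest
eigenvalue at most `1 / r`, then all links are expanders. -/
theorem isLocalExpander_cosetComplex [DecidableEq ι] {r : ℝ}
    (hgen : ∀ T : Finset ι, T.card + 2 ≤ Fintype.card ι →
      cosetStabilizer K T ≤ Subgroup.closure {k | ∃ i ∉ T, k ∈ cosetStabilizer K (insert i T)})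
    (hbase : ∀ T : Finset ι, T.card + 2 = Fintype.card ι → ∀ i ∉ T, ∀ j ∉ T, i ≠ j →
      ∀ φ ψ : Γ → ℝ, (∀ h, ∀ k ∈ K i, φ (h * k) = φ h) → (∀ h, ∀ k ∈ K j, ψ (h * k) = ψ h) →
      ∑ h : cosetStabilizer K T, (φ h + ψ h) = 0 →
      2 * ∑ h : cosetStabilizer K T, φ h * ψ h ≤
        1 / r * ∑ h : cosetStabilizer K T, (φ h ^ 2 + ψ h ^ 2))
    (hr : (Fintype.card ι : ℝ) - 2 < r) (s : Finset (CosetVertex K))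
    (hs : s.card + 2 ≤ Fintype.card ι) :
    IsLocalExpander (cosetTopFace K) (Fintype.card ι) s
      (1 / (r - ((Fintype.card ι : ℝ) - 2))) := by
  obtain ⟨m, hm⟩ := Nat.exists_eq_add_of_le hs
  refine (isLocalExpander_of_base card_cosetTopFace (isLinkConnected_coset hgen)
    (isLocalExpander_coset_base hbase) hr m s hm.symm).mono (by omega)
    (one_div_le_one_div_of_le (by linarith) ?_)
  rw [hm]
  push_cast
  have h2 : (0 : ℝ) ≤ s.card := by positivity
  linarith

end CosetLinks

namespace KaufmanOppenheim

/-! ### Staircase matrices -/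

section Staircase

variable {d : ℕ}

/-- The number of steps `j ↦ j + 1` modulo `d` that lead from `x` to `y`. -/
def cycDist (x y : Fin d) : ℕ := if x ≤ y then y.1 - x.1 else y.1 + d - x.1

theorem finRotate_val (j : Fin d) :
    (finRotate d j).1 = if j.1 + 1 = d then 0 else j.1 + 1 := by
  obtain _ | n := d
  · exact j.elim0
  · by_cases h : j = Fin.last n
    · simp [h]
    · rw [coe_finRotate_of_ne_last h, if_neg]
      intro h'
      exact h (Fin.ext (by simpa using h'))

theorem cycDist_lt (x y : Fin d) : cycDist x y < d := by
  have := x.2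
  have := y.2
  unfold cycDist
  split_ifs with h
  · omega
  · rw [Fin.le_def] at h
    omega

theorem cycDist_eq_zero {x y : Fin d} : cycDist x y = 0 ↔ x = y := by
  have := x.2
  have := y.2
  rw [Fin.ext_iff]
  unfold cycDist
  split_ifs with h <;> rw [Fin.le_def] at h <;> omega

theorem cycDist_add {x y z : Fin d} (h : cycDist x y + cycDist y z < d) :
    cycDist x z = cycDist x y + cycDist y z := by
  have := x.2
  have := y.2
  have := z.2
  revert h
  simp only [cycDist, Fin.le_def]
  split_ifs <;> omega

theorem cycDist_add_of_le {x y t : Fin d} (h : cycDist x y ≤ cycDist x t) :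
    cycDist x t = cycDist x y + cycDist y t := by
  have := x.2
  have := y.2
  have := t.2
  revert h
  simp only [cycDist, Fin.le_def]
  split_ifs <;> omega

theorem cycDist_finRotate (hd : 2 ≤ d) (j : Fin d) : cycDist j (finRotate d j) = 1 := by
  have := j.2
  simp only [cycDist, Fin.le_def, finRotate_val]
  split_ifs <;> omega

theorem finRotate_ne (hd : 2 ≤ d) (j : Fin d) : j ≠ finRotate d j := by
  intro h
  have := cycDist_finRotate hd j
  rw [cycDist_eq_zero.2 h] at this
  omega

theorem eq_finRotate_of_cycDist {x y : Fin d} (h : cycDist x y = 1) : y = finRotate d x := by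
  have := x.2
  have := y.2
  rw [Fin.ext_iff, finRotate_val]
  revert h
  simp only [cycDist, Fin.le_def]
  split_ifs <;> omega

theorem exists_cycDist_pred (hd : 2 ≤ d) {x z : Fin d} {n : ℕ} (h : cycDist x z = n + 1) :
    ∃ y, cycDist x y = n ∧ finRotate d y = z := by
  refine ⟨(finRotate d).symm z, ?_, Equiv.apply_symm_apply _ _⟩
  obtain ⟨y, rfl⟩ := (finRotate d).surjective z
  rw [Equiv.symm_apply_apply]
  have := x.2
  have := y.2
  revert h
  simp only [cycDist, Fin.le_def, finRotate_val]
  split_ifs <;> omega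

/-- The arc from `x` to `y` contains no step `t ↦ t + 1` with `t ∈ T`. -/
def Allowed (T : Finset (Fin d)) (x y : Fin d) : Prop := ∀ t ∈ T, cycDist x y ≤ cycDist x t

theorem allowed_self (T : Finset (Fin d)) (x : Fin d) : Allowed T x x := fun t _ => by
  rw [cycDist_eq_zero.2 rfl]
  exact Nat.zero_le _

theorem Allowed.trans {T : Finset (Fin d)} (hT : T.Nonempty) {x y z : Fin d}
    (h : Allowed T x y) (h' : Allowed T y z) :
    Allowed T x z ∧ cycDist x z = cycDist x y + cycDist y z := by
  have key : ∀ t ∈ T, cycDist x y + cycDist y z ≤ cycDist x t := fun t ht => by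
    rw [cycDist_add_of_le (h t ht)]
    exact Nat.add_le_add_left (h' t ht) _
  obtain ⟨t₀, ht₀⟩ := hT
  have hadd := cycDist_add ((key t₀ ht₀).trans_lt (cycDist_lt x t₀))
  exact ⟨fun t ht => hadd ▸ key t ht, hadd⟩

theorem allowed_finRotate (hd : 2 ≤ d) {T : Finset (Fin d)} {j : Fin d} (hj : j ∉ T) :
    Allowed T j (finRotate d j) := by
  intro t ht
  rw [cycDist_finRotate hd, Nat.one_le_iff_ne_zero, Ne, cycDist_eq_zero]
  rintro rfl
  exact hj ht

variable (F : Type*) [Field F] (s : ℕ)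

variable {F s} in
/-- The subspace of the elements `a t + b` of an algebra. -/
def linSubspace {S : Type*} [CommRing S] [Algebra F S] (t : S) : Submodule F S where
  carrier := {r | ∃ a b : F, algebraMap F S a * t + algebraMap F S b = r}
  zero_mem' := ⟨0, 0, by simp⟩
  add_mem' := by
    rintro _ _ ⟨a, b, rfl⟩ ⟨a', b', rfl⟩
    refine ⟨a + a', b + b', ?_⟩
    rw [map_add, map_add]
    ring
  smul_mem' := by
    rintro c _ ⟨a, b, rfl⟩
    refine ⟨c * a, c * b, ?_⟩
    rw [Algebra.smul_def, map_mul, map_mul]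
    ring

open Polynomial in
/-- The subspace of the elements `a t + b` of `R`. -/
noncomputable def linSub := linSubspace (F := F) (Ideal.Quotient.mk _ X : R F s)

theorem mem_linSub {r : R F s} : r ∈ linSub F s ↔ ∃ a b, linElt F s a b = r := by
  have h : ∀ a b, linElt F s a b = algebraMap F (R F s) a * Ideal.Quotient.mk _ Polynomial.X +
      algebraMap F (R F s) b := by
    intro a b
    rw [linElt, map_add, map_mul]
    rfl
  simp only [h]
  rfl

variable {F} {S : Type*} [CommRing S] [Algebra F S]

open Classical in
/-- The possible entries at `(x, y)` of a matrix in the stabiliser of a face of type `T`: zero if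
the arc from `x` to `y` meets `T`, and otherwise a sum of products of linear polynomials, as many
as the arc has steps. -/
noncomputable def entrySub (L : Submodule F S) (T : Finset (Fin d)) (x y : Fin d) : Submodule F S :=
  if Allowed T x y then L ^ cycDist x y else ⊥

variable {L : Submodule F S}

/-- The matrices with diagonal entries `1` and all entries in `entrySub`. -/
def IsStaircase (L : Submodule F S) (T : Finset (Fin d)) (M : Matrix (Fin d) (Fin d) (S)) : Prop :=
  (∀ x, M x x = 1) ∧ ∀ x y, M x y ∈ entrySub L T x y

theorem one_mem_entrySub (T : Finset (Fin d)) (x : Fin d) : (1 : S) ∈ entrySub L T x x := by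
  rw [entrySub, if_pos (allowed_self T x), cycDist_eq_zero.2 rfl, pow_zero]
  exact Submodule.one_le.1 le_rfl

theorem isStaircase_one (T : Finset (Fin d)) :
    IsStaircase L T (1 : Matrix (Fin d) (Fin d) (S)) := by
  refine ⟨fun x => Matrix.one_apply_eq x, fun x y => ?_⟩
  by_cases h : x = y
  · subst h
    rw [Matrix.one_apply_eq]
    exact one_mem_entrySub T x
  · rw [Matrix.one_apply_ne h]
    exact zero_mem _

theorem isStaircase_transvection {T : Finset (Fin d)} {x y : Fin d} (hxy : x ≠ y) {r : S}
    (hr : r ∈ entrySub L T x y) : IsStaircase L T (Matrix.transvection x y r) := by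
  have h1 := isStaircase_one (L := L) T
  constructor
  · intro z
    rw [Matrix.transvection, Matrix.add_apply, Matrix.one_apply_eq, Matrix.single_apply_of_ne,
      add_zero]
    rintro ⟨rfl, rfl⟩
    exact hxy rfl
  · intro z w
    rw [Matrix.transvection, Matrix.add_apply]
    refine add_mem (h1.2 z w) ?_
    by_cases h : x = z ∧ y = w
    · obtain ⟨rfl, rfl⟩ := h
      rwa [Matrix.single_apply_same]
    · rw [Matrix.single_apply_of_ne _ _ _ _ _ h]
      exact zero_mem _

theorem mul_mem_entrySub {T : Finset (Fin d)} (hT : T.Nonempty) {x y z : Fin d} {a b : S}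
    (ha : a ∈ entrySub L T x y) (hb : b ∈ entrySub L T y z) :
    a * b ∈ entrySub L T x z := by
  unfold entrySub at ha hb
  split_ifs at ha hb with h1 h2 h2
  · obtain ⟨h3, h4⟩ := h1.trans hT h2
    rw [entrySub, if_pos h3, h4, pow_add]
    exact Submodule.mul_mem_mul ha hb
  all_goals simp_all

/-- Staircase matrices are closed under products, because arcs that avoid a nonempty set of steps
can be concatenated without winding around the cycle. -/
theorem IsStaircase.mul {T : Finset (Fin d)} (hT : T.Nonempty)
    {M N : Matrix (Fin d) (Fin d) (S)} (hM : IsStaircase L T M) (hN : IsStaircase L T N) :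
    IsStaircase L T (M * N) := by
  constructor
  · intro x
    rw [Matrix.mul_apply, sum_eq_single x, hM.1, hN.1, one_mul]
    · intro y _ hyx
      have h1 := hM.2 x y
      have h2 := hN.2 y x
      unfold entrySub at h1 h2
      split_ifs at h1 h2 with h3 h4
      · have h5 := (h3.trans hT h4).2
        rw [cycDist_eq_zero.2 rfl] at h5
        exact absurd (cycDist_eq_zero.1 (by omega : cycDist y x = 0)) hyx
      all_goals simp_all
    · simp
  · intro x z
    rw [Matrix.mul_apply]
    exact sum_mem fun y _ => mul_mem_entrySub hT (hM.2 x y) (hN.2 y z)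

theorem isStaircase_of_singletons {T : Finset (Fin d)} (hT : T.Nonempty)
    {M : Matrix (Fin d) (Fin d) (S)} (hM : ∀ t ∈ T, IsStaircase L {t} M) : IsStaircase L T M := by
  obtain ⟨t₀, ht₀⟩ := hT
  refine ⟨(hM t₀ ht₀).1, fun x y => ?_⟩
  by_cases h : Allowed T x y
  · have h1 := (hM t₀ ht₀).2 x y
    have h2 : Allowed {t₀} x y := fun t ht => by
      rw [mem_singleton.1 ht]
      exact h t₀ ht₀
    rw [entrySub, if_pos h2] at h1
    rwa [entrySub, if_pos h]
  · obtain ⟨t, ht, hlt⟩ : ∃ t ∈ T, ¬ cycDist x y ≤ cycDist x t := by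
      simpa [Allowed] using h
    have h1 := (hM t ht).2 x y
    have h2 : ¬ Allowed {t} x y := fun h' => hlt (h' t (mem_singleton_self t))
    rw [entrySub, if_neg h2] at h1
    rwa [entrySub, if_neg h]

end Staircase

/-! ### Products of transvections -/

section Transvections

variable {n S : Type*} [Fintype n] [DecidableEq n] [CommRing S]

theorem transvection_commutator {x y z : n} (hxy : x ≠ y) (hxz : x ≠ z) (a b : S) :
    Matrix.transvection x y a * Matrix.transvection y z b =
      Matrix.transvection y z b * Matrix.transvection x y a * Matrix.transvection x z (a * b) := by
  simp [Matrix.transvection, mul_add, add_mul, Matrix.single_mul_single_of_ne, hxy.symm, hxz.symm]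
  abel

theorem transvection_mul_of_ne {x y x' y' : n} (h : y ≠ x') (a b : S) :
    Matrix.transvection x y a * Matrix.transvection x' y' b =
      1 + Matrix.single x y a + Matrix.single x' y' b := by
  simp [Matrix.transvection, mul_add, add_mul, Matrix.single_mul_single_of_ne, h, add_assoc]

theorem transvection_comm_of_ne {x y x' y' : n} (h : y ≠ x') (h' : y' ≠ x) (a b : S) :
    Matrix.transvection x y a * Matrix.transvection x' y' b =
      Matrix.transvection x' y' b * Matrix.transvection x y a := by
  rw [transvection_mul_of_ne h, transvection_mul_of_ne h']
  abel

end Transvections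

/-! ### The stabilisers of the faces -/

section Stabilizers

variable {F : Type*} [Field F] {s d : ℕ}

/-- The matrix of an element of `G`. -/
noncomputable def mat (g : G F s d) : Matrix (Fin d) (Fin d) (R F s) := g.1.1

theorem mat_injective : Function.Injective (mat (F := F) (s := s) (d := d)) := fun _ _ h =>
  Subtype.ext (Subtype.ext h)

theorem mat_mul (g h : G F s d) : mat (g * h) = mat g * mat h := rfl

theorem mat_one : mat (1 : G F s d) = 1 := rfl

variable (F s) in
/-- The subgroup of `G` generated by the elementary matrices `e_{j,j+1}(a t + b)` with `j ∉ T`. -/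
noncomputable def genSub (T : Finset (Fin d)) : Subgroup (G F s d) :=
  Subgroup.closure {g | ∃ j ∉ T, ∃ r ∈ linSub F s, mat g = Matrix.transvection j (finRotate d j) r}

theorem mem_K_of_transvection {i j : Fin d} (hji : j ≠ i) {r : R F s} (hr : r ∈ linSub F s)
    {g : G F s d} (hg : mat g = Matrix.transvection j (finRotate d j) r) : g ∈ K F s d i := by
  obtain ⟨a, b, rfl⟩ := (mem_linSub F s).1 hr
  exact Subgroup.subset_closure ⟨j, hji, a, b, hg⟩

theorem genSub_le_cosetStabilizer (T : Finset (Fin d)) :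
    genSub F s T ≤ cosetStabilizer (K F s d) T := by
  rw [genSub, Subgroup.closure_le]
  rintro g ⟨j, hj, r, hr, hg⟩
  refine mem_cosetStabilizer.2 fun i hi => mem_K_of_transvection ?_ hr hg
  rintro rfl
  exact hj hi

theorem exists_transvection_mem_G (hd : 2 ≤ d) (j : Fin d) {r : R F s} (hr : r ∈ linSub F s) :
    ∃ g : G F s d, mat g = Matrix.transvection j (finRotate d j) r := by
  obtain ⟨a, b, rfl⟩ := (mem_linSub F s).1 hr
  have hne := finRotate_ne hd j
  have h : (⟨Matrix.transvection j (finRotate d j) (linElt F s a b),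
      Matrix.det_transvection_of_ne _ _ hne _⟩ : Matrix.SpecialLinearGroup (Fin d) (R F s)) ∈
      subgroupSL F s d (finRotate d j) :=
    Subgroup.subset_closure ⟨j, hne, a, b, rfl⟩
  exact ⟨⟨_, (le_iSup (fun i => subgroupSL F s d i) (finRotate d j)) h⟩, rfl⟩

theorem isStaircase_of_mem_K (hd : 2 ≤ d) {i : Fin d} {g : G F s d} (hg : g ∈ K F s d i) :
    IsStaircase (linSub F s) {i} (mat g) := by
  have key : ∀ A ∈ subgroupSL F s d i, IsStaircase (linSub F s) {i} A.1 := by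
    intro A hA
    have hgen : ∀ B : Matrix.SpecialLinearGroup (Fin d) (R F s), ∀ j ≠ i, ∀ r ∈ linSub F s,
        B.1 = Matrix.transvection j (finRotate d j) r → IsStaircase (linSub F s) {i} B.1 := by
      intro B j hj r hr hB
      have hj' : j ∉ ({i} : Finset (Fin d)) := by simpa using hj
      rw [hB]
      refine isStaircase_transvection (finRotate_ne hd j) ?_
      rw [entrySub, if_pos (allowed_finRotate hd hj'), cycDist_finRotate hd, pow_one]
      exact hr
    induction hA using Subgroup.closure_induction_right with
    | one => exact isStaircase_one _
    | mul_right A _ B hB ih =>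
      obtain ⟨j, hj, a, b, hB⟩ := hB
      exact ih.mul (singleton_nonempty i) (hgen B j hj _ ((mem_linSub F s).2 ⟨a, b, rfl⟩) hB)
    | mul_inv_cancel A _ B hB ih =>
      obtain ⟨j, hj, a, b, hB⟩ := hB
      refine ih.mul (singleton_nonempty i) (hgen B⁻¹ j hj _
        (neg_mem ((mem_linSub F s).2 ⟨a, b, rfl⟩)) ?_)
      have h1 : (B⁻¹).1 * B.1 = 1 := congrArg Subtype.val (inv_mul_cancel B)
      refine left_inv_eq_right_inv h1 ?_
      rw [hB, Matrix.transvection_mul_transvection_same _ _ (finRotate_ne hd j), add_neg_cancel,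
        Matrix.transvection_zero]
  exact key g.1 hg

theorem isStaircase_of_mem_cosetStabilizer (hd : 2 ≤ d) {T : Finset (Fin d)} (hT : T.Nonempty)
    {g : G F s d} (hg : g ∈ cosetStabilizer (K F s d) T) : IsStaircase (linSub F s) T (mat g) :=
  isStaircase_of_singletons hT fun t ht =>
    isStaircase_of_mem_K hd (mem_cosetStabilizer.1 hg t ht)

/-- The subgroup generated by the `e_{j,j+1}(a t + b)` contains the elementary matrices of higher
degree along longer arcs, which are commutators of those along shorter ones. -/
theorem exists_mem_genSub_transvection_pow (hd : 2 ≤ d) {T : Finset (Fin d)} (n : ℕ) :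
    ∀ {x y : Fin d}, cycDist x y = n + 1 → Allowed T x y → ∀ r ∈ linSub F s ^ (n + 1),
      ∃ g ∈ genSub F s T, mat g = Matrix.transvection x y r := by
  induction n with
  | zero =>
    intro x y hxy hT r hr
    rw [zero_add] at hxy hr
    rw [pow_one] at hr
    obtain rfl := eq_finRotate_of_cycDist hxy
    obtain ⟨g, hg⟩ := exists_transvection_mem_G hd x hr
    refine ⟨g, Subgroup.subset_closure ⟨x, fun hx => ?_, r, hr, hg⟩, hg⟩
    have := hT x hx
    rw [hxy, cycDist_eq_zero.2 rfl] at this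
    omega
  | succ n ih =>
    intro x z hxz hT r hr
    obtain ⟨y, hxy, rfl⟩ := exists_cycDist_pred hd hxz
    have hTxy : Allowed T x y := fun t ht => by
      have := hT t ht
      omega
    have hy : y ∉ T := fun hy => by
      have := hT y hy
      omega
    have hne : ∀ {u v : Fin d}, cycDist u v ≠ 0 → u ≠ v := fun h h' => h (cycDist_eq_zero.2 h')
    have hxy' : x ≠ y := hne (by omega)
    have hxz' : x ≠ finRotate d y := hne (by omega)
    rw [pow_succ] at hr
    induction hr using Submodule.mul_induction_on' with
    | mem_mul_mem a ha b hb =>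
      obtain ⟨g, hgT, hg⟩ := ih hxy hTxy a ha
      obtain ⟨h, hh⟩ := exists_transvection_mem_G hd y hb
      have hhT : h ∈ genSub F s T := Subgroup.subset_closure ⟨y, hy, b, hb, hh⟩
      refine ⟨(h * g)⁻¹ * (g * h), mul_mem (inv_mem (mul_mem hhT hgT)) (mul_mem hgT hhT), ?_⟩
      have h1 : mat (g * h) = mat (h * g) * Matrix.transvection x (finRotate d y) (a * b) := by
        rw [mat_mul, mat_mul, hg, hh]
        exact transvection_commutator hxy' hxz' a b
      rw [mat_mul, h1, ← mul_assoc, ← mat_mul, inv_mul_cancel, mat_one, one_mul]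
    | add a _ b _ iha ihb =>
      obtain ⟨g, hgT, hg⟩ := iha
      obtain ⟨h, hhT, hh⟩ := ihb
      refine ⟨g * h, mul_mem hgT hhT, ?_⟩
      rw [mat_mul, hg, hh, Matrix.transvection_mul_transvection_same _ _ hxz']

theorem exists_mem_genSub_transvection (hd : 2 ≤ d) {T : Finset (Fin d)} {x y : Fin d}
    (hxy : x ≠ y) {r : R F s} (hr : r ∈ entrySub (linSub F s) T x y) :
    ∃ g ∈ genSub F s T, mat g = Matrix.transvection x y r := by
  by_cases h : Allowed T x y
  · rw [entrySub, if_pos h] at hr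
    obtain ⟨n, hn⟩ := Nat.exists_eq_succ_of_ne_zero fun h0 => hxy (cycDist_eq_zero.1 h0)
    rw [hn] at hr
    exact exists_mem_genSub_transvection_pow hd n hn h r hr
  · rw [entrySub, if_neg h, Submodule.mem_bot] at hr
    exact ⟨1, one_mem _, by rw [hr, Matrix.transvection_zero, mat_one]⟩

theorem exists_mem_genSub_column (hd : 2 ≤ d) {T : Finset (Fin d)} {y : Fin d} {c : Fin d → R F s}
    (hc : ∀ x, c x ∈ entrySub (linSub F s) T x y) (X : Finset (Fin d)) (hy : y ∉ X) :
    ∃ g ∈ genSub F s T, mat g = 1 + ∑ x ∈ X, Matrix.single x y (c x) := by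
  induction X using Finset.induction_on with
  | empty => exact ⟨1, one_mem _, by rw [sum_empty, add_zero, mat_one]⟩
  | insert x X hx ih =>
    rw [mem_insert, not_or] at hy
    obtain ⟨g, hgT, hg⟩ := ih hy.2
    obtain ⟨h, hhT, hh⟩ := exists_mem_genSub_transvection hd (Ne.symm hy.1) (hc x)
    refine ⟨g * h, mul_mem hgT hhT, ?_⟩
    rw [mat_mul, hg, hh, Matrix.transvection, add_mul, one_mul, mul_add, mul_one, sum_mul,
      sum_insert hx, sum_eq_zero (s := X) (f := fun z => Matrix.single z y (c z) *
        Matrix.single x y (c x))]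
    · abel
    · intro z _
      exact Matrix.single_mul_single_of_ne _ _ _ _ hy.1 _

/-- Gaussian elimination, column by column: staircase matrices are products of generators. -/
theorem mem_genSub_of_isStaircase (hd : 2 ≤ d) {T : Finset (Fin d)} (hT : T.Nonempty)
    (Y : Finset (Fin d)) : ∀ g : G F s d, IsStaircase (linSub F s) T (mat g) →
      (∀ y ∉ Y, ∀ x ≠ y, mat g x y = 0) → g ∈ genSub F s T := by
  induction Y using Finset.induction_on with
  | empty =>
    intro g hg h
    have : g = 1 := mat_injective (by
      ext x y
      by_cases hxy : x = y
      · rw [hxy, hg.1, mat_one, Matrix.one_apply_eq]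
      · rw [h y (notMem_empty y) x hxy, mat_one, Matrix.one_apply_ne hxy])
    rw [this]
    exact one_mem _
  | insert y Y _ ih =>
    intro g hg h
    obtain ⟨k, hkT, hk⟩ := exists_mem_genSub_column hd (T := T) (y := y)
      (c := fun x => -mat g x y) (fun x => neg_mem (hg.2 x y)) (univ.erase y) (notMem_erase y _)
    have hentry : ∀ x z, mat (k * g) x z =
        mat g x z + if x = y then 0 else -mat g x y * mat g y z := by
      intro x z
      rw [mat_mul, hk, add_mul, one_mul, Matrix.add_apply, sum_mul, Matrix.sum_apply]
      congr 1
      by_cases hxy : x = y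
      · rw [if_pos hxy]
        refine sum_eq_zero fun w hw => ?_
        refine Matrix.single_mul_apply_of_ne _ _ _ _ _ ?_ _
        rw [hxy]
        exact (ne_of_mem_erase hw).symm
      · rw [if_neg hxy, sum_eq_single x, Matrix.single_mul_apply_same]
        · intro w _ hwx
          exact Matrix.single_mul_apply_of_ne _ _ _ _ _ hwx.symm _
        · intro hx
          exact absurd (mem_erase.2 ⟨hxy, mem_univ x⟩) hx
    have hks := isStaircase_of_mem_cosetStabilizer hd hT (genSub_le_cosetStabilizer T hkT)
    have hkg := ih (k * g) (hks.mul hT hg) fun z hz x hxz => by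
      rw [hentry]
      by_cases hzy : z = y
      · rw [hzy] at hxz ⊢
        rw [if_neg hxz, hg.1]
        ring
      · have hz' : z ∉ insert y Y := by
          rw [mem_insert, not_or]
          exact ⟨hzy, hz⟩
        rw [h z hz' x hxz, h z hz' y (Ne.symm hzy)]
        simp
    exact (Subgroup.mul_mem_cancel_left _ hkT).1 hkg

theorem cosetStabilizer_eq_genSub (hd : 2 ≤ d) {T : Finset (Fin d)} (hT : T.Nonempty) :
    cosetStabilizer (K F s d) T = genSub F s T :=
  le_antisymm (fun g hg => mem_genSub_of_isStaircase hd hT univ g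
    (isStaircase_of_mem_cosetStabilizer hd hT hg) fun y hy => absurd (mem_univ y) hy)
    (genSub_le_cosetStabilizer T)

theorem genSub_empty : genSub F s (∅ : Finset (Fin d)) = ⊤ := by
  have h : G F s d ≤ (genSub F s (∅ : Finset (Fin d))).map (G F s d).subtype := by
    refine iSup_le fun i => (Subgroup.closure_le _).2 ?_
    rintro A ⟨j, hj, a, b, hA⟩
    have hAG : A ∈ G F s d :=
      (le_iSup (fun i => subgroupSL F s d i) i) (Subgroup.subset_closure ⟨j, hj, a, b, hA⟩)
    exact ⟨⟨A, hAG⟩, Subgroup.subset_closure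
      ⟨j, notMem_empty j, _, (mem_linSub F s).2 ⟨a, b, rfl⟩, hA⟩, rfl⟩
  refine eq_top_iff.2 fun g _ => ?_
  obtain ⟨g', hg', he⟩ := h g.2
  rwa [← Subtype.ext he]

theorem cosetStabilizer_le_genSub (hd : 2 ≤ d) (T : Finset (Fin d)) :
    cosetStabilizer (K F s d) T ≤ genSub F s T := by
  rcases T.eq_empty_or_nonempty with rfl | hT
  · rw [genSub_empty]
    exact le_top
  · exact (cosetStabilizer_eq_genSub hd hT).le

theorem cosetStabilizer_univ (hd : 2 ≤ d) : cosetStabilizer (K F s d) univ = ⊥ := by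
  rw [cosetStabilizer_eq_genSub hd ⟨⟨0, by omega⟩, mem_univ _⟩, genSub]
  simp

/-- Each generator `e_{j,j+1}` fixes a further vertex, of a type other than `j`. -/
theorem cosetStabilizer_le_closure (hd : 2 ≤ d) (T : Finset (Fin d)) (hT : T.card + 2 ≤ d) :
    cosetStabilizer (K F s d) T ≤
      Subgroup.closure {k | ∃ i ∉ T, k ∈ cosetStabilizer (K F s d) (insert i T)} := by
  refine (cosetStabilizer_le_genSub hd T).trans ((Subgroup.closure_le _).2 ?_)
  rintro g ⟨j, hj, r, hr, hg⟩
  obtain ⟨i, hi⟩ : ∃ i, i ∉ insert j T := by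
    by_contra! h
    have h1 := card_le_card fun i (_ : i ∈ (univ : Finset (Fin d))) => h i
    rw [card_univ, Fintype.card_fin, card_insert_of_notMem hj] at h1
    omega
  rw [mem_insert, not_or] at hi
  refine Subgroup.subset_closure ⟨i, hi.2, genSub_le_cosetStabilizer _
    (Subgroup.subset_closure ⟨j, ?_, r, hr, hg⟩)⟩
  rw [mem_insert, not_or]
  exact ⟨Ne.symm hi.1, hj⟩

end Stabilizers

/-! ### The links of codimension two -/

section Base

variable {F : Type*} [Field F] {s d : ℕ}

/-- The multiplication of linear polynomials, with values in the quadratic ones. -/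
noncomputable def linMul (F : Type*) [Field F] (s : ℕ) :
    linSub F s →+ linSub F s →+ (linSub F s * linSub F s : Submodule F (R F s)) :=
  AddMonoidHom.mk' (fun a => AddMonoidHom.mk'
    (fun b => ⟨a.1 * b.1, Submodule.mul_mem_mul a.2 b.2⟩)
    fun b b' => Subtype.ext (mul_add a.1 b.1 b'.1))
    fun a a' => AddMonoidHom.ext fun b => Subtype.ext (add_mul a.1 a'.1 b.1)

theorem linMul_apply (a b : linSub F s) : (linMul F s a b : R F s) = a.1 * b.1 := rfl

theorem linMul_smul (r : F) (a b : linSub F s) : linMul F s (r • a) b = linMul F s a (r • b) := by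
  apply Subtype.ext
  rw [linMul_apply, linMul_apply]
  exact (smul_mul_assoc r a.1 b.1).trans (mul_smul_comm r a.1 b.1).symm

theorem closure_linMul : AddSubgroup.closure {c | ∃ a b, linMul F s a b = c} = ⊤ := by
  refine eq_top_iff.2 fun c _ => ?_
  obtain ⟨c, hc⟩ := c
  induction hc using Submodule.mul_induction_on' with
  | mem_mul_mem a ha b hb => exact AddSubgroup.subset_closure ⟨⟨a, ha⟩, ⟨b, hb⟩, rfl⟩
  | add x hx y hy ihx ihy => exact add_mem (ihx trivial) (ihy trivial)

/-- The generators attached to `j`, as a family indexed by the linear polynomials. -/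
theorem exists_generators (hd : 2 ≤ d) (j : Fin d) : ∃ x : linSub F s → G F s d,
    ∀ a, mat (x a) = Matrix.transvection j (finRotate d j) a.1 :=
  ⟨fun a => (exists_transvection_mem_G hd j a.2).choose,
    fun a => (exists_transvection_mem_G hd j a.2).choose_spec⟩

theorem cosetStabilizer_eq_closure_pair (hd : 2 ≤ d) {T : Finset (Fin d)} (hT : T.Nonempty)
    {i j : Fin d} (hT' : ∀ l, l ∉ T ↔ l = i ∨ l = j) {x y : linSub F s → G F s d}
    (hx : ∀ a, mat (x a) = Matrix.transvection i (finRotate d i) a.1)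
    (hy : ∀ a, mat (y a) = Matrix.transvection j (finRotate d j) a.1) :
    cosetStabilizer (K F s d) T = Subgroup.closure (Set.range x ∪ Set.range y) := by
  rw [cosetStabilizer_eq_genSub hd hT, genSub]
  congr 1
  ext g
  constructor
  · rintro ⟨l, hl, r, hr, hg⟩
    rcases (hT' l).1 hl with rfl | rfl
    · exact Or.inl ⟨⟨r, hr⟩, mat_injective ((hx _).trans hg.symm)⟩
    · exact Or.inr ⟨⟨r, hr⟩, mat_injective ((hy _).trans hg.symm)⟩
  · rintro (⟨a, rfl⟩ | ⟨a, rfl⟩)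
    · exact ⟨i, (hT' i).2 (Or.inl rfl), a.1, a.2, hx a⟩
    · exact ⟨j, (hT' j).2 (Or.inr rfl), a.1, a.2, hy a⟩

theorem map_add_of_transvection {N : Submodule F (R F s)} {x y : Fin d} (hxy : x ≠ y)
    {e : N → G F s d} (he : ∀ a, mat (e a) = Matrix.transvection x y a.1) (a a' : N) :
    e (a + a') = e a * e a' :=
  mat_injective (by
    rw [mat_mul, he, he, he, Matrix.transvection_mul_transvection_same _ _ hxy]
    rfl)

variable [Fintype F]

/-- Consecutive types: the stabiliser is a Heisenberg group with commutator pairing `linMul`. -/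
theorem base_bound_consecutive (hd : 3 ≤ d) {T : Finset (Fin d)} (hT : T.Nonempty) {i j : Fin d}
    (hT' : ∀ l, l ∉ T ↔ l = j ∨ l = i) (hij : finRotate d j = i)
    [Fintype (cosetStabilizer (K F s d) T)] {φ ψ : G F s d → ℝ}
    (hφ : ∀ h, ∀ k ∈ K F s d i, φ (h * k) = φ h) (hψ : ∀ h, ∀ k ∈ K F s d j, ψ (h * k) = ψ h)
    (hmean : ∑ h : cosetStabilizer (K F s d) T, (φ h + ψ h) = 0) :
    2 * ∑ h : cosetStabilizer (K F s d) T, φ h * ψ h ≤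
      1 / √(Fintype.card F) * ∑ h : cosetStabilizer (K F s d) T, (φ h ^ 2 + ψ h ^ 2) := by
  classical
  have hd2 : 2 ≤ d := by omega
  have : Finite (R F s) := finite_R F s
  have : Fintype (linSub F s) := Fintype.ofFinite _
  have : Fintype (linSub F s * linSub F s : Submodule F (R F s)) := Fintype.ofFinite _
  set k := finRotate d i with hk
  have hji : j ≠ i := hij ▸ finRotate_ne hd2 j
  have hik : i ≠ k := finRotate_ne hd2 i
  have hdik : cycDist i k = 1 := cycDist_finRotate hd2 i
  have hdji : cycDist j i = 1 := hij ▸ cycDist_finRotate hd2 j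
  have hdjk : cycDist j k = 2 := by
    rw [cycDist_add (y := i) (by omega)]
    omega
  have hjk : j ≠ k := fun h => by
    rw [cycDist_eq_zero.2 h] at hdjk
    omega
  have hallow : Allowed T j k := by
    intro t ht
    rw [hdjk]
    by_contra h
    have h1 : cycDist j t = 0 ∨ cycDist j t = 1 := by omega
    rcases h1 with h1 | h1
    · exact (hT' t).2 (Or.inl (cycDist_eq_zero.1 h1).symm) ht
    · exact (hT' t).2 (Or.inr ((eq_finRotate_of_cycDist h1).trans hij)) ht
  obtain ⟨x, hx⟩ := exists_generators (F := F) (s := s) hd2 j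
  obtain ⟨y, hy⟩ := exists_generators (F := F) (s := s) hd2 i
  have hH := cosetStabilizer_eq_closure_pair hd2 hT hT' hx hy
  rw [hij] at hx
  rw [← hk] at hy
  have hzex : ∀ c : (linSub F s * linSub F s : Submodule F (R F s)), ∃ g : G F s d,
      mat g = Matrix.transvection j k c.1 := by
    intro c
    have hc : c.1 ∈ entrySub (linSub F s) T j k := by
      rw [entrySub, if_pos hallow, hdjk, pow_two]
      exact c.2
    obtain ⟨g, -, hg⟩ := exists_mem_genSub_transvection hd2 hjk hc
    exact ⟨g, hg⟩
  choose z hz using hzex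
  have hentries : ∀ b c a, mat (y b * z c * x a) = 1 + Matrix.single i k b.1 +
      Matrix.single j k c.1 + Matrix.single j i a.1 := by
    intro b c a
    rw [mat_mul, mat_mul, hx, hy, hz, transvection_mul_of_ne hjk.symm, Matrix.transvection,
      mul_add, mul_one, add_mul, add_mul, one_mul, Matrix.single_mul_single_of_ne _ _ _ _ hjk.symm,
      Matrix.single_mul_single_of_ne _ _ _ _ hjk.symm, add_zero, add_zero]
  refine heisenberg_group_bound (linMul F s) linMul_smul closure_linMul (x := x) (y := y) (z := z)
    (map_add_of_transvection hji hx) (map_add_of_transvection hik hy)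
    (map_add_of_transvection hjk hz) (fun a b => mat_injective ?_) (fun a c => mat_injective ?_)
    (fun b c => mat_injective ?_) (fun b c a b' c' a' h => ?_) hH (fun h a => hφ h _ ?_)
    (fun h b => hψ h _ ?_) hmean
  · rw [mat_mul, mat_mul, mat_mul, hx, hy, hz]
    exact transvection_commutator hji hjk a.1 b.1
  · rw [mat_mul, mat_mul, hx, hz]
    exact transvection_comm_of_ne hji.symm hjk.symm _ _
  · rw [mat_mul, mat_mul, hy, hz]
    exact transvection_comm_of_ne hjk.symm hik.symm _ _
  · have h1 := congrArg mat h
    rw [hentries, hentries] at h1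
    have hentry := fun u v => congrFun (congrFun h1 u) v
    refine ⟨Subtype.ext ?_, Subtype.ext ?_, Subtype.ext ?_⟩
    · simpa [Matrix.single_apply, hji, hik, hjk] using hentry i k
    · simpa [Matrix.single_apply, hji.symm, hik, hjk] using hentry j k
    · simpa [Matrix.single_apply, hji, hji.symm, hik.symm, hjk] using hentry j i
  · exact mem_K_of_transvection hji a.2 (by rw [hx, hij])
  · exact mem_K_of_transvection hji.symm b.2 (hy b)

/-- Types that are not consecutive: the stabiliser is a direct product. -/
theorem base_bound_commuting (hd : 2 ≤ d) {T : Finset (Fin d)} (hT : T.Nonempty) {i j : Fin d}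
    (hT' : ∀ l, l ∉ T ↔ l = j ∨ l = i) (hne : i ≠ j) (hij : finRotate d j ≠ i)
    (hji : finRotate d i ≠ j) [Fintype (cosetStabilizer (K F s d) T)] {φ ψ : G F s d → ℝ}
    (hφ : ∀ h, ∀ k ∈ K F s d i, φ (h * k) = φ h) (hψ : ∀ h, ∀ k ∈ K F s d j, ψ (h * k) = ψ h)
    (hmean : ∑ h : cosetStabilizer (K F s d) T, (φ h + ψ h) = 0) :
    2 * ∑ h : cosetStabilizer (K F s d) T, φ h * ψ h ≤
      1 / √(Fintype.card F) * ∑ h : cosetStabilizer (K F s d) T, (φ h ^ 2 + ψ h ^ 2) := by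
  classical
  have : Finite (R F s) := finite_R F s
  have : Fintype (linSub F s) := Fintype.ofFinite _
  obtain ⟨x, hx⟩ := exists_generators (F := F) (s := s) hd j
  obtain ⟨y, hy⟩ := exists_generators (F := F) (s := s) hd i
  have hH := cosetStabilizer_eq_closure_pair hd hT hT' hx hy
  have hspan : AddSubgroup.closure {c : PUnit.{1} | ∃ a b : linSub F s,
      (0 : linSub F s →+ linSub F s →+ PUnit.{1}) a b = c} = ⊤ := Subsingleton.elim _ _
  refine heisenberg_group_bound (0 : linSub F s →+ linSub F s →+ PUnit.{1}) (fun _ _ _ => rfl)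
    hspan (x := x) (y := y) (z := fun _ => 1) (map_add_of_transvection (finRotate_ne hd j) hx)
    (map_add_of_transvection (finRotate_ne hd i) hy) (fun _ _ => (one_mul 1).symm)
    (fun a b => mat_injective ?_) (fun _ _ => by rw [mul_one, one_mul])
    (fun _ _ => by rw [mul_one, one_mul]) (fun b c a b' c' a' h => ?_) hH
    (fun h a => hφ h _ (mem_K_of_transvection hne.symm a.2 (hx a)))
    (fun h b => hψ h _ (mem_K_of_transvection hne b.2 (hy b))) hmean
  · rw [mul_one, mat_mul, mat_mul, hx, hy]
    exact transvection_comm_of_ne hij hji _ _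
  · have h1 := congrArg mat h
    rw [mul_one, mul_one, mat_mul, mat_mul, hx, hy, hx, hy, transvection_mul_of_ne hji,
      transvection_mul_of_ne hji] at h1
    have hentry := fun u v => congrFun (congrFun h1 u) v
    refine ⟨Subtype.ext ?_, rfl, Subtype.ext ?_⟩
    · simpa [Matrix.single_apply, hne, hne.symm] using hentry i (finRotate d i)
    · simpa [Matrix.single_apply, hne, hne.symm] using hentry j (finRotate d j)

theorem base_bound (hd : 3 ≤ d) {T : Finset (Fin d)} (hTc : T.card + 2 = d) {i j : Fin d}
    (hi : i ∉ T) (hj : j ∉ T) (hne : i ≠ j) [Fintype (cosetStabilizer (K F s d) T)]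
    {φ ψ : G F s d → ℝ}
    (hφ : ∀ h, ∀ k ∈ K F s d i, φ (h * k) = φ h) (hψ : ∀ h, ∀ k ∈ K F s d j, ψ (h * k) = ψ h)
    (hmean : ∑ h : cosetStabilizer (K F s d) T, (φ h + ψ h) = 0) :
    2 * ∑ h : cosetStabilizer (K F s d) T, φ h * ψ h ≤
      1 / √(Fintype.card F) * ∑ h : cosetStabilizer (K F s d) T, (φ h ^ 2 + ψ h ^ 2) := by
  have hT : T.Nonempty := card_pos.1 (by omega)
  have hcompl : Tᶜ = {j, i} := by
    symm
    refine eq_of_subset_of_card_le ?_ ?_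
    · simp [insert_subset_iff, hi, hj]
    · rw [card_compl, Fintype.card_fin, card_pair hne.symm]
      omega
  have hT' : ∀ l, l ∉ T ↔ l = j ∨ l = i := fun l => by
    rw [← mem_compl, hcompl, mem_insert, mem_singleton]
  by_cases h1 : finRotate d j = i
  · exact base_bound_consecutive hd hT hT' h1 hφ hψ hmean
  by_cases h2 : finRotate d i = j
  · have h := base_bound_consecutive hd hT (fun l => (hT' l).trans or_comm) h2 hψ hφ
      (by simpa only [add_comm] using hmean)
    simpa only [mul_comm (ψ _), add_comm (ψ _ ^ 2)] using h
  · exact base_bound_commuting (by omega) hT hT' hne h1 h2 hφ hψ hmean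

end Base

/-! ### The skeleta of the complex -/

section Complex

variable (F : Type*) [Field F] [Fintype F] (s d : ℕ)

open Classical in
/-- The links of the complex are expanders. Above dimension one, the bound for the links of
codimension two trickles down; in dimension one, `1` bounds all eigenvalues. -/
theorem isLocalExpander_link (hd : 2 ≤ d) (hp : ((d : ℝ) - 2) ^ 2 < Fintype.card F)
    [Fintype (G F s d)] {k : ℕ} (hkd : k < d) (S : Finset (CosetVertex (K F s d)))
    (hS : S.card + 1 ≤ k) :
    IsLocalExpander (cosetTopFace (K F s d)) d S
      (max (1 / (√(Fintype.card F) - ((d : ℝ) - 2))) (1 / ((d : ℝ) - k))) := by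
  have htop : ∀ g : G F s d, (cosetTopFace (K F s d) g).card = d := fun g => by
    rw [card_cosetTopFace, Fintype.card_fin]
  rcases hd.eq_or_lt with hd2 | hd3
  · have hk : k = 1 := by omega
    refine (isLocalExpander_one htop S).mono (by omega) (le_max_of_le_right ?_)
    rw [hk, ← hd2]
    norm_num
  have hr : (d : ℝ) - 2 < √(Fintype.card F) := Real.lt_sqrt_of_sq_lt hp
  have h := isLocalExpander_cosetComplex (K := K F s d) (r := √(Fintype.card F))
    (fun T hT => cosetStabilizer_le_closure hd T (by rwa [Fintype.card_fin] at hT))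
    (fun T hT i hi j hj hij φ ψ hφ hψ hmean =>
      base_bound hd3 (by rwa [Fintype.card_fin] at hT) hi hj hij hφ hψ hmean)
    (by rwa [Fintype.card_fin]) S (by rw [Fintype.card_fin]; omega)
  rw [Fintype.card_fin] at h
  exact h.mono (by omega) (le_max_left _ _)

theorem isSpectralHDX_skeleton (hd : 2 ≤ d) (hp : ((d : ℝ) - 2) ^ 2 < Fintype.card F) {k : ℕ}
    (hk : 1 ≤ k) (hkd : k < d) :
    ((complex F s d).skeleton k).IsSpectralHDX (weight F s d) k
      (max (1 / (√(Fintype.card F) - ((d : ℝ) - 2))) (1 / ((d : ℝ) - k))) := by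
  classical
  have : Fintype (G F s d) := Fintype.ofFinite _
  exact skeleton_isSpectralHDX (X := complex F s d) (top := cosetTopFace (K F s d))
    (fun σ => Iff.rfl) (fun g => by rw [card_cosetTopFace, Fintype.card_fin])
    (cosetTopFace_injective (cosetStabilizer_univ hd)) hk hkd (le_max_right _ _)
    fun S _ hS => isLocalExpander_link F s d hd hp hkd S hS

theorem weight_empty (hd : 2 ≤ d) : weight F s d ∅ = 1 := by
  have : Fintype (G F s d) := Fintype.ofFinite _
  have h := sum_uniformWeight (X := complex F s d) (top := cosetTopFace (K F s d)) (d := d)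
    (fun σ => Iff.rfl) (fun g => by rw [card_cosetTopFace, Fintype.card_fin])
    (cosetTopFace_injective (cosetStabilizer_univ hd)) (Nat.zero_le d)
  rwa [powersetCard_zero, sum_singleton] at h

end Complex

end KaufmanOppenheim

theorem mainTheorem2 (F : Type*) [Field F] [Fintype F] (s d : ℕ) (hs : 1 ≤ s) (hd : 2 ≤ d)
    (hp : ((d : ℝ) - 2) ^ 2 < (Fintype.card F : ℝ)) :
    (∀ k : ℕ, 1 ≤ k → k < d →
      ((KaufmanOppenheim.complex F s d).skeleton k).IsSpectralHDX
        (KaufmanOppenheim.weight F s d) k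
        (max (1 / (Real.sqrt (Fintype.card F) - ((d : ℝ) - 2))) (1 / ((d : ℝ) - (k : ℝ))))) ∧
    ((KaufmanOppenheim.complex F s d).skeleton 1).IsSpectralExpander
      (KaufmanOppenheim.weight F s d)
      (max (1 / (Real.sqrt (Fintype.card F) - ((d : ℝ) - 2))) (1 / ((d : ℝ) - 1))) := by
  refine ⟨fun k hk hkd => KaufmanOppenheim.isSpectralHDX_skeleton F s d hd hp hk hkd, ?_⟩
  have h := KaufmanOppenheim.isSpectralHDX_skeleton F s d hd hp le_rfl (by omega : 1 < d)
  rw [Nat.cast_one] at h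
  exact isSpectralExpander_of_isSpectralHDX (KaufmanOppenheim.weight_empty F s d hd)
    ⟨1, empty_subset _⟩ h
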